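/- Let $\Gamma=\mathrm{SL}_2(\mathbb Z)$ act on the upper half plane $\mathbb H$, let $\Gamma_\infty=\{\pm\begin{pmatrix}1&n\\0&1\end{pmatrix}: n\in\mathbb Z\}$, write $j(\gamma,z)=cz+d$ for $\gamma=\begin{pmatrix}a&b\\c&d\end{pmatrix}$ and $z=x+iy$ throughout. For $k\in 2\mathbb Z$ and $\mathrm{Re}(s)>1$ put $$E_k(z,s)=\sum_{\gamma\in\Gamma_\infty\backslash\Gamma}\left(\frac{j(\gamma,z)}{|j(\gamma,z)|}\right)^{-k}\mathrm{Im}(\gamma z)^s,\qquad E_k^*(z,s)=\theta_k(s)E_k(z,s),$$ where $\theta_k(s)=\pi^{-s}\,\Gamma(s+|k|/2)\,\zeta(2s)$ is regarded as a meromorphic function of $s\in\mathbb C$ (with removable singularities removed). Let $\sigma_w(m)=\sum_{d\mid m}d^w$ and $$K_w(y)=\frac12\int_0^\infty e^{-y(t+1/t)/2}t^{w-1}\,dt\quad (w\in\mathbb C,\ y>0),$$ $$W_s(z)=2|y|^{1/2}K_{s-1/2}(2\pi|y|)\,e^{2\pi i x}\quad(s\in\mathbb C,\ z\in\mathbb C\setminus\mathbb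 R).$$ For $n,r\in\mathbb Z$ with $n\ge 0$ let $$P^n_r(x)=\sum_{\ell=|r|}^{n}\frac{(2n)!}{(n-\ell)!\,(\ell+r)!\,(\ell-r)!}(-x)^\ell,$$ and let $P^n_r(x)=(-1)^rP^{-n}_r(-x)$ for $n<0$. **Theorem.** Let $k\in2\mathbb Z$. (i) For all $z\in\mathbb H$ and $s\in\mathbb C$ with $\mathrm{Re}(s)>1$, the series $E_k(z,s)$ converges absolutely and $$E_k^*(z,s)=\theta_k(s)y^s+\theta_k(1-s)y^{1-s}+2^{-|k|}\sum_{m\in\mathbb Z_{\ne0}}\frac{\sigma_{2s-1}(|m|)}{|m|^s}\sum_{r=-|k|/2}^{|k|/2}\left(\frac{m}{|m|}\right)^rP^{k/2}_r(4\pi my)\,W_{s+r}(mz).\qquad(*)$$ (ii) The series over $m$ on the right of $(*)$ converges absolutely for all $(z,s)\in\mathbb H\times\mathbb C$, and it and the series of absolute values of its terms converge uniformly on compact subsets of $\mathbb H\times\mathbb C$. (iii) For each $z\in\mathbb H$ the right side of $(*)$ gives the meromorphic continuation of $E_k^*(z,s)$ to all $s\in\mathbb C$: there is a meromorphic function on $\mathbb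 C$ that equals $E_k^*(z,s)$ for $\mathrm{Re}(s)>1$ and equals the right side of $(*)$ at every $s$ at which neither $\theta_k(s)$ nor $\theta_k(1-s)$ has a pole, that is, for every $s\neq 1/2$ if $k\ne0$ and every $s\notin\{0,1/2,1\}$ if $k=0$. If $k\neq0$, this continuation is an entire function of $s$. -/

import Mathlib

open scoped MatrixGroups Topology Nat

noncomputable section

namespace NonholomorphicEisenstein

/-- The subgroup `{± (1 n; 0 1) : n ∈ ℤ}` of `SL(2, ℤ)`. -/
def GammaInfty : Subgroup SL(2, ℤ) where
  carrier := {γ | ∃ n : ℤ, (γ : Matrix (Fin 2) (Fin 2) ℤ) = !![1, n; 0, 1] ∨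
    (γ : Matrix (Fin 2) (Fin 2) ℤ) = -!![1, n; 0, 1]}
  one_mem' := ⟨0, Or.inl (by ext i j; fin_cases i <;> fin_cases j <;> simp)⟩
  mul_mem' := by
    rintro a b ⟨m, hm⟩ ⟨n, hn⟩
    refine ⟨m + n, ?_⟩
    rw [Matrix.SpecialLinearGroup.coe_mul]
    rcases hm with hm | hm <;> rcases hn with hn | hn <;> rw [hm, hn] <;>
      simp [add_comm]
  inv_mem' := by
    rintro a ⟨m, hm⟩
    refine ⟨-m, ?_⟩
    rw [Matrix.SpecialLinearGroup.coe_inv]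
    rcases hm with hm | hm <;> rw [hm] <;> simp [Matrix.adjugate_fin_two]

/-- The automorphy factor `j((a b; c d), z) = c z + d`. -/
def autFactor (γ : SL(2, ℤ)) (z : UpperHalfPlane) : ℂ :=
  ((γ 1 0 : ℤ) : ℂ) * (z : ℂ) + ((γ 1 1 : ℤ) : ℂ)

/-- `(j(γ, z) / |j(γ, z)|)^(-k) * Im(γ z)^s`. -/
def summand (k : ℤ) (z : UpperHalfPlane) (s : ℂ) (γ : SL(2, ℤ)) : ℂ :=
  (autFactor γ z / (‖autFactor γ z‖ : ℂ)) ^ (-k) * (((γ • z).im : ℝ) : ℂ) ^ s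

/-- For even `k` the summand depends only on the coset of `γ` in `Γ_∞ \ Γ`. -/
theorem summand_mul_left {k : ℤ} (hk : Even k) (z : UpperHalfPlane) (s : ℂ)
    {g : SL(2, ℤ)} (hg : g ∈ GammaInfty) (γ : SL(2, ℤ)) :
    summand k z s (g * γ) = summand k z s γ := by
  obtain ⟨n, hn⟩ := hg
  have hj : autFactor (g * γ) z = autFactor γ z ∨ autFactor (g * γ) z = -autFactor γ z := by
    unfold autFactor
    rw [Matrix.SpecialLinearGroup.coe_mul]
    rcases hn with hn | hn <;> rw [hn] <;> simp [Matrix.mul_apply, Fin.sum_univ_two]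
    right; ring
  have hnorm : ‖autFactor (g * γ) z‖ = ‖autFactor γ z‖ := by
    rcases hj with h | h <;> simp [h]
  have hden : ∀ δ : SL(2, ℤ), (δ • z).im = z.im / ‖autFactor δ z‖ ^ 2 := by
    intro δ
    rw [ModularGroup.im_smul_eq_div_normSq, ← Complex.normSq_eq_norm_sq]
    rfl
  unfold summand
  rw [hden, hden, hnorm]
  rcases hj with h | h <;> rw [h]
  rw [neg_div, hk.neg.neg_zpow]

/-- The coset space `Γ_∞ \ Γ`. -/
abbrev Cosets : Type := Quotient (QuotientGroup.rightRel GammaInfty)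

/-- The term of the Eisenstein series at a coset in `Γ_∞ \ Γ`. -/
def cosetTerm (k : ℤ) (hk : Even k) (z : UpperHalfPlane) (s : ℂ) (q : Cosets) : ℂ :=
  Quotient.lift (summand k z s) (fun a b hab => by
    have h : b * a⁻¹ ∈ GammaInfty := QuotientGroup.rightRel_apply.mp hab
    have := summand_mul_left hk z s h a
    rw [inv_mul_cancel_right] at this
    exact this.symm) q

/-- The weight `k` non-holomorphic Eisenstein series `E_k(z, s)` (for `Re s > 1`). -/
def eisenstein (k : ℤ) (hk : Even k) (z : UpperHalfPlane) (s : ℂ) : ℂ :=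
  ∑' q : Cosets, cosetTerm k hk z s q

/-- The meromorphic function `θ_k(s) = π^(-s) Γ(s + |k|/2) ζ(2s)`. The punctured limit gives it its
true value at the removable singularities, where `Γ` has a pole and `ζ(2s)` a zero. -/
def theta (k : ℤ) (s : ℂ) : ℂ :=
  Filter.limUnder (𝓝[≠] s) fun w : ℂ =>
    (Real.pi : ℂ) ^ (-w) * Complex.Gamma (w + ((|k| : ℤ) : ℂ) / 2) * riemannZeta (2 * w)

/-- The completed Eisenstein series `E*_k(z, s) = θ_k(s) E_k(z, s)` (for `Re s > 1`). -/
def completedEisenstein (k : ℤ) (hk : Even k) (z : UpperHalfPlane) (s : ℂ) : ℂ :=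
  theta k s * eisenstein k hk z s

/-- The modified Bessel function `K_w(y)`, for `y > 0`. -/
def besselK (w : ℂ) (y : ℝ) : ℂ :=
  1 / 2 * ∫ t in Set.Ioi (0 : ℝ), (Real.exp (-y * (t + 1 / t) / 2) : ℂ) * (t : ℂ) ^ (w - 1)

/-- `W_s(z) = 2 |y|^(1/2) K_{s-1/2}(2π|y|) e^(2πix)` for `z = x + iy` not real. -/
def whittakerW (s z : ℂ) : ℂ :=
  2 * (Real.sqrt |z.im| : ℂ) * besselK (s - 1 / 2) (2 * Real.pi * |z.im|) *
    Complex.exp (2 * Real.pi * Complex.I * z.re)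

/-- The divisor power sum `σ_w(m) = ∑_{d ∣ m} d^w`. -/
def sigma (w : ℂ) (m : ℕ) : ℂ :=
  ∑ d ∈ m.divisors, (d : ℂ) ^ w

/-- The polynomial `P^n_r(x)` for `n ≥ 0`. -/
def laguerrePNonneg (n r : ℤ) (x : ℝ) : ℝ :=
  ∑ l ∈ Finset.Icc |r| n,
    ((2 * n).toNat ! : ℝ) / (((n - l).toNat ! : ℝ) * ((l + r).toNat ! : ℝ) * ((l - r).toNat ! : ℝ)) *
      (-x) ^ l.toNat

/-- The polynomial `P^n_r(x)` for all `n, r ∈ ℤ`. -/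
def laguerreP (n r : ℤ) (x : ℝ) : ℝ :=
  if 0 ≤ n then laguerrePNonneg n r x else (-1) ^ r * laguerrePNonneg (-n) r (-x)

/-- The `m`-th term, `m ≠ 0`, of the Fourier series. -/
def fourierTerm (k : ℤ) (m : {m : ℤ // m ≠ 0}) (z : UpperHalfPlane) (s : ℂ) : ℂ :=
  sigma (2 * s - 1) m.1.natAbs / (m.1.natAbs : ℂ) ^ s *
    ∑ r ∈ Finset.Icc (-(|k| / 2)) (|k| / 2),
      ((m.1 : ℂ) / (m.1.natAbs : ℂ)) ^ r * (laguerreP (k / 2) r (4 * Real.pi * m.1 * z.im) : ℂ) *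
        whittakerW (s + r) ((m.1 : ℂ) * (z : ℂ))

/-- The right hand side of the Fourier expansion. -/
def fourierExpansion (k : ℤ) (z : UpperHalfPlane) (s : ℂ) : ℂ :=
  theta k s * (z.im : ℂ) ^ s + theta k (1 - s) * (z.im : ℂ) ^ (1 - s) +
    (2 : ℂ) ^ (-|k|) * ∑' m : {m : ℤ // m ≠ 0}, fourierTerm k m z s

end NonholomorphicEisenstein

end

/-! ### Gaussian moments, Hermite polynomials and the polynomials P^n_r -/

noncomputable section

namespace NonholomorphicEisenstein

open Complex MeasureTheory Finset

/-! Put n = |k|/2. Multiplying E_k by ζ(2s) turns the sum over cosets into a sum over nonzero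
integer vectors (c, d) up to sign (`contentCoset_bijective`, `zeta_mul_eisenstein`). The row c = 0
gives ζ(2s) y^s. For c > 0 the sum over d runs over integer translates of `latticeKernel`, (x -
iv)^(2n) (x² + v²)^(-(s+n)) with v = ±cy, and Poisson summation applies.

The Fourier transform carries the argument. The factor π^(-(s+n)) Γ(s+n) writes the complex power as
a Mellin integral of exp(-πt(x² + v²)). After Fubini the x-integral is an even Gaussian moment, a
Hermite polynomial in v + ξ/t (`gaussMoment_even`). For ξ ≠ 0 and u = tv/ξ, t(v + ξ/t)² = ξv(u + 2 +
1/u), and expanding in powers of u produces P^n_r(4πξv) as the coefficient of u^r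
(`sum_laguerrePNonneg_mul_zpow`); the remaining t-integral is a Bessel function of index s - 1/2 +
r. For ξ = 0 the t-integrals are Gamma values, which Chu–Vandermonde (`sum_choose_ascPochhammer`)
adds up to the product of the 1 - s + i; with ζ(2s-1) from the sum over c and the functional
equation this is θ_k(1-s). Frequency m in row c contributes |m|^(2s-1) times a function of N = mc,
so regrouping by N gives σ_(2s-1)(|N|).

For the continuation, exponential decay of K beats all polynomial growth, so the Fourier series is
normally convergent and entire in s. Moreover θ_k(s) = Λ(2s) s(s+1)⋯(s+n-1), with Λ the completed
zeta function: the factor s removes the pole at 0 when n > 0, and the poles at 1/2 of the two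
constant terms cancel. -/

/-- The polynomial factor is dominated by a multiple of e^x + e^(-x), and multiplying the Gaussian
by e^(±x) merely moves c to c ± 1. -/
theorem integrable_pow_mul_cexp_quadratic {b : ℂ} (hb : 0 < b.re) (c p : ℂ) (m : ℕ) :
    Integrable (fun x : ℝ => ((x : ℂ) + p) ^ m * cexp (-b * (x : ℂ) ^ 2 + c * x)) := by
  have h1 := (integrable_cexp_quadratic hb (c + 1) 0).norm
  have h2 := (integrable_cexp_quadratic hb (c - 1) 0).norm
  refine (((h1.add h2).const_mul (m ! * Real.exp ‖p‖)).mono' (by fun_prop) ?_)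
  filter_upwards with x
  have e1 : ‖cexp (-b * (x : ℂ) ^ 2 + (c + 1) * x + 0)‖ =
      ‖cexp (-b * (x : ℂ) ^ 2 + c * x)‖ * Real.exp x := by
    rw [← Complex.norm_exp_ofReal x, ← norm_mul, ← Complex.exp_add]
    · congr 2; ring
  have e2 : ‖cexp (-b * (x : ℂ) ^ 2 + (c - 1) * x + 0)‖ =
      ‖cexp (-b * (x : ℂ) ^ 2 + c * x)‖ * Real.exp (-x) := by
    rw [← Complex.norm_exp_ofReal (-x), ← norm_mul, ← Complex.exp_add]
    · congr 2; push_cast; ring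
  have h3 : ‖(x : ℂ) + p‖ ^ m ≤ m ! * Real.exp ‖p‖ * (Real.exp x + Real.exp (-x)) := by
    have h := Real.pow_div_factorial_le_exp (‖(x : ℂ) + p‖) (norm_nonneg _) m
    rw [div_le_iff₀ (by positivity)] at h
    have h4 : Real.exp ‖(x : ℂ) + p‖ ≤ Real.exp ‖p‖ * Real.exp |x| := by
      rw [← Real.exp_add]
      apply Real.exp_le_exp.2
      refine (norm_add_le _ _).trans ?_
      simp [add_comm]
    have h5 : Real.exp |x| ≤ Real.exp x + Real.exp (-x) := by
      rcases abs_cases x with h | h <;> rw [h.1]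
      · linarith [Real.exp_pos (-x)]
      · linarith [Real.exp_pos x]
    calc _ ≤ Real.exp ‖(x : ℂ) + p‖ * m ! := h
      _ ≤ (Real.exp ‖p‖ * (Real.exp x + Real.exp (-x))) * m ! := by gcongr; exact h4.trans (by gcongr)
      _ = _ := by ring
  simp only [Pi.add_apply, e1, e2, norm_mul, norm_pow]
  calc _ ≤ (m ! * Real.exp ‖p‖ * (Real.exp x + Real.exp (-x))) *
      ‖cexp (-b * (x : ℂ) ^ 2 + c * x)‖ := by gcongr
    _ = _ := by ring

/-- The moments `∫ (x + p)^m exp(-b x² + c x) dx` of a Gaussian. -/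
def gaussMoment (b c p : ℂ) (m : ℕ) : ℂ :=
  ∫ x : ℝ, ((x : ℂ) + p) ^ m * cexp (-b * (x : ℂ) ^ 2 + c * x)

/-- The integrand is a total derivative. At m = 0 the truncated exponent `m - 1` is harmless, being
multiplied by m. -/
theorem integral_deriv_pow_mul_cexp {b : ℂ} (hb : 0 < b.re) (c p : ℂ) (m : ℕ) :
    ∫ x : ℝ, (((m : ℂ) * ((x : ℂ) + p) ^ (m - 1)) * cexp (-b * (x : ℂ) ^ 2 + c * x) +
      ((x : ℂ) + p) ^ m * (cexp (-b * (x : ℂ) ^ 2 + c * x) * (-b * (2 * x) + c))) = 0 := by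
  refine integral_eq_zero_of_hasDerivAt_of_integrable
    (f := fun x : ℝ => ((x : ℂ) + p) ^ m * cexp (-b * (x : ℂ) ^ 2 + c * x)) ?_ ?_ ?_
  · intro x
    have h1 : HasDerivAt (fun w : ℂ => (w + p) ^ m * cexp (-b * w ^ 2 + c * w))
        (((m : ℂ) * ((x : ℂ) + p) ^ (m - 1)) * cexp (-b * (x : ℂ) ^ 2 + c * x) +
          ((x : ℂ) + p) ^ m * (cexp (-b * (x : ℂ) ^ 2 + c * x) * (-b * (2 * x) + c))) (x : ℂ) := by
      refine HasDerivAt.fun_mul ?_ (HasDerivAt.cexp ?_)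
      · simpa using ((hasDerivAt_id (x : ℂ)).add_const p).fun_pow m
      · have := ((hasDerivAt_id (x : ℂ)).fun_pow 2).const_mul (-b)
        have h2 := (hasDerivAt_id (x : ℂ)).const_mul c
        simpa using this.fun_add h2
    exact h1.comp_ofReal
  · have h0 := (integrable_pow_mul_cexp_quadratic hb c p (m - 1)).const_mul (m : ℂ)
    have h1 := (integrable_pow_mul_cexp_quadratic hb c p (m + 1)).const_mul (-2 * b)
    have h2 := (integrable_pow_mul_cexp_quadratic hb c p m).const_mul (2 * b * p + c)
    refine ((h0.add h1).add h2).congr ?_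
    filter_upwards with x
    simp only [Pi.add_apply]
    ring
  · exact integrable_pow_mul_cexp_quadratic hb c p m

/-- Integration by parts, with -2bx + c rewritten as -2b(x + p) + (2bp + c). -/
theorem gaussMoment_rec {b : ℂ} (hb : 0 < b.re) (c p : ℂ) (m : ℕ) :
    2 * b * gaussMoment b c p (m + 1) =
      (2 * b * p + c) * gaussMoment b c p m + m * gaussMoment b c p (m - 1) := by
  have h := integral_deriv_pow_mul_cexp hb c p m
  have h0 := (integrable_pow_mul_cexp_quadratic hb c p (m - 1)).const_mul (m : ℂ)
  have h1 := (integrable_pow_mul_cexp_quadratic hb c p (m + 1)).const_mul (-2 * b)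
  have h2 := (integrable_pow_mul_cexp_quadratic hb c p m).const_mul (2 * b * p + c)
  have h3 : ∀ x : ℝ, (((m : ℂ) * ((x : ℂ) + p) ^ (m - 1)) * cexp (-b * (x : ℂ) ^ 2 + c * x) +
      ((x : ℂ) + p) ^ m * (cexp (-b * (x : ℂ) ^ 2 + c * x) * (-b * (2 * x) + c))) =
      m * (((x : ℂ) + p) ^ (m - 1) * cexp (-b * (x : ℂ) ^ 2 + c * x)) +
      (-2 * b) * (((x : ℂ) + p) ^ (m + 1) * cexp (-b * (x : ℂ) ^ 2 + c * x)) +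
      (2 * b * p + c) * (((x : ℂ) + p) ^ m * cexp (-b * (x : ℂ) ^ 2 + c * x)) := by
    intro x; ring
  simp_rw [h3] at h
  have h4 := integral_add (h0.add h1) h2
  simp only [Pi.add_apply] at h4
  rw [h4, integral_add h0 h1, integral_const_mul, integral_const_mul,
    integral_const_mul] at h
  unfold gaussMoment
  linear_combination -h

/-- Pascal's rule splits the left binomial; the part with lower index 2j + 1 is converted by
absorption to choose(m, 2j). The binomials vanish wherever truncated subtraction would spoil an
exponent. -/
theorem hermite_term_rec (e q : ℂ) (m j : ℕ) :
    ((m + 2).choose (2 * j + 2) : ℂ) * ((2 * (j + 1))! / (j + 1)!) * e ^ (j + 1) *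
        q ^ (m + 2 - 2 * (j + 1)) =
      q * (((m + 1).choose (2 * j + 2) : ℂ) * ((2 * (j + 1))! / (j + 1)!) * e ^ (j + 1) *
        q ^ (m + 1 - 2 * (j + 1))) +
      2 * (m + 1) * e * ((m.choose (2 * j) : ℂ) * ((2 * j)! / j !) * e ^ j * q ^ (m - 2 * j)) := by
  have h1 : ((m + 2).choose (2 * j + 2) : ℂ) =
      (m + 1).choose (2 * j + 1) + (m + 1).choose (2 * j + 2) := by
    rw [Nat.choose_succ_succ' (m + 1) (2 * j + 1)]; push_cast; ring
  have h2 : ((m + 1).choose (2 * j + 1) : ℂ) * (2 * j + 1) = (m + 1) * m.choose (2 * j) := by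
    have := Nat.add_one_mul_choose_eq m (2 * j)
    exact_mod_cast this.symm
  have h3 : (((2 * (j + 1))! : ℕ) : ℂ) / ((j + 1)! : ℕ) = 2 * (2 * j + 1) * (((2 * j)! : ℕ) / (j ! : ℕ)) := by
    rw [show 2 * (j + 1) = 2 * j + 1 + 1 by ring, Nat.factorial_succ, Nat.factorial_succ,
      Nat.factorial_succ]
    have : (j ! : ℂ) ≠ 0 := by exact_mod_cast Nat.factorial_ne_zero j
    have h' : (j + 1 : ℂ) ≠ 0 := by exact_mod_cast Nat.succ_ne_zero j
    push_cast
    field_simp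
    ring
  have h4 : ((m + 1).choose (2 * j + 2) : ℂ) * q ^ (m + 2 - 2 * (j + 1)) =
      ((m + 1).choose (2 * j + 2) : ℂ) * (q * q ^ (m + 1 - 2 * (j + 1))) := by
    rcases Nat.lt_or_ge (m + 1) (2 * j + 2) with h | h
    · simp [Nat.choose_eq_zero_of_lt h]
    · rw [← pow_succ']; congr 2; omega
  have h5 : m + 2 - 2 * (j + 1) = m - 2 * j := by omega
  rw [h1, add_mul, add_mul, add_mul]
  linear_combination ((2 * (j + 1))! / (j + 1)! : ℂ) * e ^ (j + 1) * h4 +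
    2 * (((2 * j)! : ℕ) / (j ! : ℕ) : ℂ) * e ^ (j + 1) * q ^ (m - 2 * j) * h2 +
    ((m + 1).choose (2 * j + 1) : ℂ) * e ^ (j + 1) * q ^ (m + 2 - 2 * (j + 1)) * h3 +
    ((m + 1).choose (2 * j + 1) : ℂ) * e ^ (j + 1) * (2 * (2 * j + 1) * (((2 * j)! : ℕ) / (j ! : ℕ))) *
      (congrArg (q ^ ·) h5)

/-- The Hermite three-term recurrence. The cutoff N is free because terms with 2j > m vanish; the
induction uses N for m and N + 1 for m + 1, so that the tails match once j = 0 is split off. -/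
theorem hermite_closed_form {g : ℕ → ℂ} {e q : ℂ} (h1 : g 1 = q * g 0)
    (hg : ∀ m, g (m + 2) = q * g (m + 1) + 2 * (m + 1) * e * g m) (m : ℕ) :
    ∀ N, m < 2 * N → g m = g 0 * ∑ j ∈ range N,
      (m.choose (2 * j) : ℂ) * ((2 * j)! / j !) * e ^ j * q ^ (m - 2 * j) := by
  induction m using Nat.twoStepInduction with
  | zero =>
    intro N hN
    obtain ⟨N, rfl⟩ : ∃ M, N = M + 1 := ⟨N - 1, by omega⟩
    rw [sum_range_succ', sum_eq_zero]
    · simp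
    · intro j _
      rw [Nat.choose_eq_zero_of_lt (by omega)]; simp
  | one =>
    intro N hN
    obtain ⟨N, rfl⟩ : ∃ M, N = M + 1 := ⟨N - 1, by omega⟩
    rw [sum_range_succ', sum_eq_zero]
    · simp [h1, mul_comm]
    · intro j _
      rw [Nat.choose_eq_zero_of_lt (by omega)]; simp
  | more m ih1 ih2 =>
    intro N hN
    obtain ⟨N, rfl⟩ : ∃ M, N = M + 1 := ⟨N - 1, by omega⟩
    rw [hg, ih1 N (by omega), ih2 (N + 1) (by omega), sum_range_succ', sum_range_succ']
    have : ∀ j, 2 * (j + 1) = 2 * j + 2 := fun j => by ring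
    have h := fun j => hermite_term_rec e q m j
    simp only [this] at h ⊢
    simp_rw [h]
    rw [sum_add_distrib, ← mul_sum, ← mul_sum]
    simp
    ring

/-- Dividing `gaussMoment_rec` by 2b gives the Hermite recurrence with q = p + c/(2b) and e =
1/(4b); the sum is then reversed by l = n - j. -/
theorem gaussMoment_even {b : ℂ} (hb : 0 < b.re) (c p : ℂ) (n : ℕ) :
    gaussMoment b c p (2 * n) = gaussMoment b c p 0 * ∑ l ∈ range (n + 1),
      ((2 * n)! / ((n - l)! * (2 * l)!) : ℂ) * (1 / (4 * b)) ^ (n - l) *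
        (p + c / (2 * b)) ^ (2 * l) := by
  have hb0 : b ≠ 0 := by rintro rfl; simp at hb
  rw [hermite_closed_form (g := gaussMoment b c p) (e := 1 / (4 * b)) (q := p + c / (2 * b)) ?_ ?_
    (2 * n) (n + 1) (by omega), ← sum_range_reflect]
  · congr 1
    apply sum_congr rfl
    intro l hl
    rw [mem_range] at hl
    have e1 : n + 1 - 1 - l = n - l := by omega
    have e2 : 2 * n - 2 * (n - l) = 2 * l := by omega
    rw [e1, e2]
    congr 2
    have h := Nat.choose_mul_factorial_mul_factorial (n := 2 * n) (k := 2 * (n - l)) (by omega)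
    rw [e2] at h
    rw [← h]
    have h1 : ((n - l)! : ℂ) ≠ 0 := by exact_mod_cast Nat.factorial_ne_zero _
    have h2 : ((2 * l)! : ℂ) ≠ 0 := by exact_mod_cast Nat.factorial_ne_zero _
    push_cast
    field_simp
  · have := gaussMoment_rec hb c p 0
    field_simp
    simp at this
    linear_combination this
  · intro m
    have := gaussMoment_rec hb c p (m + 1)
    simp at this
    refine mul_left_cancel₀ (mul_ne_zero two_ne_zero hb0) ?_
    rw [this]
    field_simp
    ring

/-- Binomial theorem for u + 2 + 1/u = (u + 1)²/u. -/
theorem sum_choose_zpow (l : ℕ) {u : ℂ} (hu : u ≠ 0) :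
    ∑ r ∈ Icc (-(l : ℤ)) l, ((2 * l).choose ((l + r).toNat) : ℂ) * u ^ r =
      (u + 2 + u⁻¹) ^ l := by
  have h1 : (u + 2 + u⁻¹) ^ l = u ^ (-(l : ℤ)) * (u + 1) ^ (2 * l) := by
    rw [zpow_neg, zpow_natCast, ← inv_pow, pow_mul, ← mul_pow]
    congr 1
    field_simp
    ring
  rw [h1, add_pow, mul_sum]
  symm
  refine sum_bij (fun i _ => (i : ℤ) - l) ?_ ?_ ?_ ?_
  · intro i hi; simp at hi ⊢; omega
  · intro i _ j _ h; simpa using h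
  · intro r hr
    simp at hr
    exact ⟨(l + r).toNat, by simp; omega, by simp; omega⟩
  · intro i hi
    rw [show ((l : ℤ) + (i - l)).toNat = i by omega, sub_eq_add_neg, zpow_add₀ hu, zpow_natCast]
    ring

/-- This generating function is the source of the P^n_r: expand each power by `sum_choose_zpow` and
exchange the sums over |r| ≤ l ≤ n. -/
theorem sum_laguerrePNonneg_mul_zpow (n : ℕ) (X : ℝ) {u : ℂ} (hu : u ≠ 0) :
    ∑ r ∈ Icc (-(n : ℤ)) n, (laguerrePNonneg n r X : ℂ) * u ^ r =
      ∑ l ∈ range (n + 1), ((2 * n)! / ((n - l)! * (2 * l)!) : ℂ) *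
        (-(X : ℂ) * (u + 2 + u⁻¹)) ^ l := by
  have h1 : ∀ l ∈ range (n + 1), ((2 * n)! / ((n - l)! * (2 * l)!) : ℂ) *
        (-(X : ℂ) * (u + 2 + u⁻¹)) ^ l = ∑ r ∈ Icc (-(l : ℤ)) l,
        ((2 * n)! : ℂ) / (((n - l : ℤ).toNat)! * ((l + r : ℤ).toNat)! * ((l - r : ℤ).toNat)!) *
          (-(X : ℂ)) ^ l * u ^ r := by
    intro l hl
    rw [mem_range] at hl
    rw [mul_pow, ← sum_choose_zpow l hu, mul_sum, mul_sum]
    apply sum_congr rfl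
    intro r hr
    rw [mem_Icc] at hr
    have h := Nat.choose_mul_factorial_mul_factorial (n := 2 * l) (k := (l + r).toNat) (by omega)
    rw [show 2 * l - (l + r : ℤ).toNat = (l - r : ℤ).toNat by omega] at h
    rw [← h, show (n - l : ℤ).toNat = n - l by omega]
    have h1 : ((n - l)! : ℂ) ≠ 0 := by exact_mod_cast Nat.factorial_ne_zero _
    have h2 : (((l + r : ℤ).toNat)! : ℂ) ≠ 0 := by exact_mod_cast Nat.factorial_ne_zero _
    have h3 : (((l - r : ℤ).toNat)! : ℂ) ≠ 0 := by exact_mod_cast Nat.factorial_ne_zero _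
    have h4 : ((2 * l).choose (l + r : ℤ).toNat : ℂ) ≠ 0 := by
      exact_mod_cast (Nat.choose_pos (by omega)).ne'
    push_cast
    field_simp
  rw [sum_congr rfl h1]
  have h2 : ∀ r ∈ Icc (-(n : ℤ)) n, (laguerrePNonneg n r X : ℂ) * u ^ r =
      ∑ l ∈ (range (n + 1)).filter (fun l : ℕ => |r| ≤ (l : ℤ)),
        ((2 * n)! : ℂ) / (((n - l : ℤ).toNat)! * ((l + r : ℤ).toNat)! * ((l - r : ℤ).toNat)!) *
          (-(X : ℂ)) ^ l * u ^ r := by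
    intro r _
    unfold laguerrePNonneg
    push_cast
    rw [sum_mul]
    refine sum_bij (fun l _ => l.toNat) ?_ ?_ ?_ ?_
    · intro l hl
      rw [mem_Icc] at hl
      have := abs_nonneg r
      rw [mem_filter, mem_range]; omega
    · intro a ha b hb hab
      rw [mem_Icc] at ha hb
      have := abs_nonneg r
      omega
    · intro l hl
      rw [mem_filter, mem_range] at hl
      exact ⟨l, by rw [mem_Icc]; omega, by simp⟩
    · intro l hl
      rw [mem_Icc] at hl
      have := abs_nonneg r
      rw [show (2 * (n : ℤ)).toNat = 2 * n by omega, Int.toNat_of_nonneg (by omega : 0 ≤ l)]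
  rw [sum_congr rfl h2]
  apply sum_comm'
  intro r l
  simp only [mem_filter, mem_range, mem_Icc, abs_le]
  omega

/-- Chu–Vandermonde, by induction on n for all a at once: writing a - w = (a + l) - (w + l) splits
each term for a + 1 into two, which Pascal's rule recombines. -/
theorem sum_choose_ascPochhammer (n : ℕ) (w : ℂ) : ∀ a : ℂ,
    ∑ l ∈ range (n + 1), (n.choose l : ℂ) * (-1) ^ l * (∏ i ∈ range l, (w + i)) *
      (∏ i ∈ range (n - l), (a + l + i)) = ∏ i ∈ range n, (a - w + i) := by
  induction n with
  | zero => simp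
  | succ n ih =>
    intro a
    have key : ∏ i ∈ range (n + 1), (a - w + i) = (a - w) * ∏ i ∈ range n, (a + 1 - w + i) := by
      rw [prod_range_succ', mul_comm]
      congr 1
      · simp
      · apply prod_congr rfl; intro i _; push_cast; ring
    rw [key, ← ih (a + 1), mul_sum]
    have h1 : ∀ l ∈ range (n + 1), (a - w) * ((n.choose l : ℂ) * (-1) ^ l *
        (∏ i ∈ range l, (w + i)) * (∏ i ∈ range (n - l), (a + 1 + l + i))) =
        (n.choose l : ℂ) * (-1) ^ l * (∏ i ∈ range l, (w + i)) *
          (∏ i ∈ range (n + 1 - l), (a + l + i)) +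
        (n.choose l : ℂ) * (-1) ^ (l + 1) * (∏ i ∈ range (l + 1), (w + i)) *
          (∏ i ∈ range (n - l), (a + (l + 1 : ℕ) + i)) := by
      intro l hl
      rw [mem_range] at hl
      rw [show n + 1 - l = (n - l) + 1 by omega, prod_range_succ' _ (n - l), prod_range_succ _ l]
      have e1 : ∏ i ∈ range (n - l), (a + 1 + l + i) = ∏ i ∈ range (n - l), (a + (l + 1 : ℕ) + i) := by
        apply prod_congr rfl; intro i _; push_cast; ring
      have e2 : ∏ i ∈ range (n - l), (a + l + (i + 1 : ℕ)) =
          ∏ i ∈ range (n - l), (a + (l + 1 : ℕ) + i) := by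
        apply prod_congr rfl; intro i _; push_cast; ring
      rw [e1, e2]
      push_cast
      ring
    have h3 := sum_range_succ (fun l => (n.choose l : ℂ) * (-1) ^ l *
      (∏ i ∈ range l, (w + i)) * (∏ i ∈ range (n + 1 - l), (a + l + i))) (n + 1)
    rw [Nat.choose_succ_self, Nat.cast_zero, zero_mul, zero_mul, zero_mul, add_zero] at h3
    rw [sum_congr rfl h1, sum_add_distrib, ← h3, sum_range_succ' _ (n + 1),
      sum_range_succ' _ (n + 1)]
    have h2 : ∀ l, ((n + 1).choose (l + 1) : ℂ) = n.choose l + n.choose (l + 1) := by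
      intro l; exact_mod_cast Nat.choose_succ_succ' n l
    simp_rw [h2, add_mul, sum_add_distrib]
    simp only [Nat.add_sub_add_right, Nat.choose_zero_right]
    ring

end NonholomorphicEisenstein
end

/-! ### The Bessel function K_w: analyticity, decay and the Mellin integral -/

noncomputable section

namespace NonholomorphicEisenstein

open Complex MeasureTheory Set Filter Asymptotics

/-- The kernel `exp(-y (t + 1/t) / 2)` of the Bessel function. -/
def besselKernel (y t : ℝ) : ℂ := (Real.exp (-y * (t + 1 / t) / 2) : ℂ)

theorem norm_besselKernel (y t : ℝ) : ‖besselKernel y t‖ = Real.exp (-y * (t + 1 / t) / 2) := by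
  rw [besselKernel, Complex.norm_real, Real.norm_eq_abs, abs_of_pos (Real.exp_pos _)]

theorem besselK_eq_mellin (w : ℂ) (y : ℝ) : besselK w y = 1 / 2 * mellin (besselKernel y) w := by
  unfold besselK mellin besselKernel
  simp only [smul_eq_mul, mul_comm]

theorem continuousOn_besselKernel (y : ℝ) : ContinuousOn (besselKernel y) (Ioi 0) := by
  unfold besselKernel
  refine continuous_ofReal.comp_continuousOn (Real.continuous_exp.comp_continuousOn ?_)
  have : ContinuousOn (fun t : ℝ => 1 / t) (Ioi 0) :=
    continuousOn_const.div continuousOn_id fun t ht => (ne_of_gt ht)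
  fun_prop

theorem isBigO_besselKernel_atTop {y : ℝ} (hy : 0 < y) (a : ℝ) :
    besselKernel y =O[atTop] fun t : ℝ => t ^ a := by
  refine IsBigO.trans ?_ (isLittleO_exp_neg_mul_rpow_atTop (half_pos hy) a).isBigO
  refine IsBigO.of_bound 1 ?_
  filter_upwards [eventually_gt_atTop 0] with t ht
  rw [norm_besselKernel, one_mul, Real.norm_eq_abs, abs_of_pos (Real.exp_pos _)]
  apply Real.exp_le_exp.2
  have : 0 < y * (1 / t) := by positivity
  linarith

theorem besselKernel_inv (y t : ℝ) : besselKernel y t⁻¹ = besselKernel y t := by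
  unfold besselKernel
  congr 4
  rw [one_div, one_div, inv_inv, add_comm]

/-- The symmetry t ↦ 1/t carries decay at infinity to decay at 0. -/
theorem isBigO_besselKernel_zero {y : ℝ} (hy : 0 < y) (a : ℝ) :
    besselKernel y =O[𝓝[>] 0] fun t : ℝ => t ^ a := by
  have h := (isBigO_besselKernel_atTop hy (-a)).comp_tendsto tendsto_inv_nhdsGT_zero
  refine (h.congr' ?_ ?_)
  · filter_upwards with t
    simp [besselKernel_inv]
  · filter_upwards [self_mem_nhdsWithin] with t ht
    simp only [Function.comp]
    rw [Real.inv_rpow (le_of_lt ht), Real.rpow_neg (le_of_lt ht), inv_inv]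

theorem mellinConvergent_besselKernel {y : ℝ} (hy : 0 < y) (w : ℂ) :
    MellinConvergent (besselKernel y) w :=
  mellinConvergent_of_isBigO_rpow
    ((continuousOn_besselKernel y).locallyIntegrableOn measurableSet_Ioi)
    (isBigO_besselKernel_atTop hy (-(w.re + 1))) (by linarith)
    (isBigO_besselKernel_zero hy (-(w.re - 1))) (by linarith)

theorem differentiable_besselK {y : ℝ} (hy : 0 < y) : Differentiable ℂ fun w => besselK w y := by
  intro w
  simp_rw [besselK_eq_mellin]
  exact (mellin_differentiableAt_of_isBigO_rpow
    ((continuousOn_besselKernel y).locallyIntegrableOn measurableSet_Ioi)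
    (isBigO_besselKernel_atTop hy (-(w.re + 1))) (by linarith)
    (isBigO_besselKernel_zero hy (-(w.re - 1))) (by linarith)).const_mul _

/-- Since t + 1/t ≥ 2, half of the exponent already supplies e^(-y/2); the other half, with y
replaced by y₀, makes the integral converge. The power of t is bounded by the sum of its two extreme
cases Re w = ±A. -/
theorem exists_norm_besselK_le (A : ℝ) {y₀ : ℝ} (hy₀ : 0 < y₀) :
    ∃ C : ℝ, 0 ≤ C ∧ ∀ (w : ℂ) (y : ℝ), |w.re| ≤ A → y₀ ≤ y →
      ‖besselK w y‖ ≤ C * Real.exp (-y / 2) := by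
  have hi : ∀ a : ℝ, IntegrableOn (fun t : ℝ => Real.exp (-(y₀ / 2) * (t + 1 / t) / 2) * t ^ (a - 1))
      (Ioi 0) := by
    intro a
    refine IntegrableOn.congr_fun (mellinConvergent_besselKernel (half_pos hy₀) (a : ℂ)).norm ?_
      measurableSet_Ioi
    intro t ht
    simp only [norm_smul, norm_besselKernel]
    rw [norm_cpow_eq_rpow_re_of_pos ht, mul_comm]
    simp
  have hi2 := ((hi A).add (hi (-A)))
  refine ⟨∫ t in Ioi (0 : ℝ), (Real.exp (-(y₀ / 2) * (t + 1 / t) / 2) * t ^ (A - 1) +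
    Real.exp (-(y₀ / 2) * (t + 1 / t) / 2) * t ^ (-A - 1)), ?_, ?_⟩
  · refine setIntegral_nonneg measurableSet_Ioi fun t ht => ?_
    have : (0 : ℝ) < t := ht
    positivity
  · intro w y hw hy
    rw [besselK_eq_mellin, norm_mul, mellin]
    have h1 : ‖∫ t in Ioi (0 : ℝ), (t : ℂ) ^ (w - 1) • besselKernel y t‖ ≤
        ∫ t in Ioi (0 : ℝ), (Real.exp (-(y₀ / 2) * (t + 1 / t) / 2) * t ^ (A - 1) +
          Real.exp (-(y₀ / 2) * (t + 1 / t) / 2) * t ^ (-A - 1)) * Real.exp (-y / 2) := by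
      refine norm_integral_le_of_norm_le (hi2.mul_const _) ?_
      refine (ae_restrict_iff' measurableSet_Ioi).2 (Eventually.of_forall fun t ht => ?_)
      have ht : 0 < t := ht
      rw [norm_smul, norm_besselKernel, norm_cpow_eq_rpow_re_of_pos ht, ← mul_add]
      have h2 : Real.exp (-y * (t + 1 / t) / 2) ≤
          Real.exp (-(y₀ / 2) * (t + 1 / t) / 2) * Real.exp (-y / 2) := by
        rw [← Real.exp_add]
        apply Real.exp_le_exp.2
        have h3 : 2 ≤ t + 1 / t := by
          rw [← sub_nonneg]
          have : t + 1 / t - 2 = (t - 1) ^ 2 / t := by field_simp; ring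
          rw [this]; positivity
        nlinarith [mul_nonneg (sub_nonneg.2 hy) (by linarith : 0 ≤ t + 1 / t)]
      have h4 : t ^ (w - 1).re ≤ t ^ (A - 1) + t ^ (-A - 1) := by
        rw [abs_le] at hw
        rw [sub_re, one_re]
        rcases le_total 1 t with h | h
        · have := Real.rpow_le_rpow_of_exponent_le h (by linarith : w.re - 1 ≤ A - 1)
          have := Real.rpow_nonneg ht.le (-A - 1)
          linarith
        · have := Real.rpow_le_rpow_of_exponent_ge ht h (by linarith : -A - 1 ≤ w.re - 1)
          have := Real.rpow_nonneg ht.le (A - 1)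
          linarith
      calc _ ≤ (t ^ (A - 1) + t ^ (-A - 1)) *
            (Real.exp (-(y₀ / 2) * (t + 1 / t) / 2) * Real.exp (-y / 2)) := by gcongr
        _ = _ := by ring
    rw [integral_mul_const] at h1
    refine le_trans ?_ h1
    norm_num
    linarith [norm_nonneg (∫ t in Ioi (0 : ℝ), (t : ℂ) ^ (w - 1) * besselKernel y t)]

/-- Rescaling t by p/q makes the two parts of the exponent symmetric. -/
theorem integral_cpow_mul_exp_eq_besselK {p q : ℝ} (hp : 0 < p) (hq : 0 < q) (w : ℂ) :
    ∫ t in Ioi (0 : ℝ), (t : ℂ) ^ (w - 1) *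
      (Real.exp (-(Real.pi * p ^ 2 * t + Real.pi * q ^ 2 / t)) : ℂ) =
      ((q / p : ℝ) : ℂ) ^ w * (2 * besselK w (2 * Real.pi * (p * q))) := by
  have h := mellin_comp_mul_left (besselKernel (2 * Real.pi * (p * q))) w (div_pos hp hq)
  rw [besselK_eq_mellin]
  have h2 : ((p / q : ℝ) : ℂ) ^ (-w) = ((q / p : ℝ) : ℂ) ^ w := by
    rw [cpow_neg, ← inv_cpow, ← ofReal_inv, inv_div]
    rw [arg_ofReal_of_nonneg (by positivity)]
    exact Real.pi_pos.ne
  rw [h2, smul_eq_mul] at h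
  rw [show (2 : ℂ) * (1 / 2 * mellin (besselKernel (2 * Real.pi * (p * q))) w) =
    mellin (besselKernel (2 * Real.pi * (p * q))) w by ring, ← h, mellin]
  refine setIntegral_congr_fun measurableSet_Ioi fun t ht => ?_
  have ht : 0 < t := ht
  simp only [smul_eq_mul, besselKernel]
  congr 4
  field_simp

theorem integrableOn_cpow_mul_exp {p q : ℝ} (hp : 0 < p) (hq : 0 < q) (w : ℂ) :
    IntegrableOn (fun t : ℝ => (t : ℂ) ^ (w - 1) *
      (Real.exp (-(Real.pi * p ^ 2 * t + Real.pi * q ^ 2 / t)) : ℂ)) (Ioi 0) := by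
  have h := (MellinConvergent.comp_mul_left (div_pos hp hq)).2
    (mellinConvergent_besselKernel (y := 2 * Real.pi * (p * q)) (by positivity)
      w)
  refine IntegrableOn.congr_fun h ?_ measurableSet_Ioi
  intro t ht
  have ht : 0 < t := ht
  simp only [smul_eq_mul, besselKernel]
  congr 4
  field_simp

end NonholomorphicEisenstein
end

/-! ### The Fourier transform of the lattice kernel -/

noncomputable section

namespace NonholomorphicEisenstein

open Complex MeasureTheory Set Filter FourierTransform

/-- The function `(x - i v)^(2n) / (x² + v²)^(s + n)`. -/
def latticeKernel (n : ℕ) (v : ℝ) (s : ℂ) (x : ℝ) : ℂ :=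
  ((x : ℂ) - I * v) ^ (2 * n) * ((x ^ 2 + v ^ 2 : ℝ) : ℂ) ^ (-(s + n))

theorem norm_sub_I_mul_sq (x v : ℝ) : ‖(x : ℂ) - I * v‖ ^ 2 = x ^ 2 + v ^ 2 := by
  rw [← normSq_eq_norm_sq, normSq_apply]
  simp
  ring

theorem continuous_latticeKernel (n : ℕ) {v : ℝ} (hv : v ≠ 0) (s : ℂ) :
    Continuous (latticeKernel n v s) := by
  unfold latticeKernel
  refine Continuous.mul (by fun_prop) ?_
  refine Continuous.cpow (by fun_prop) continuous_const fun x => ?_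
  rw [ofReal_mem_slitPlane]
  positivity

theorem norm_latticeKernel (n : ℕ) {v : ℝ} (hv : v ≠ 0) (s : ℂ) (x : ℝ) :
    ‖latticeKernel n v s x‖ = (x ^ 2 + v ^ 2) ^ (-s.re) := by
  have h : 0 < x ^ 2 + v ^ 2 := by positivity
  rw [latticeKernel, norm_mul, norm_pow, pow_mul, norm_sub_I_mul_sq, norm_cpow_eq_rpow_re_of_pos h,
    ← Real.rpow_natCast, ← Real.rpow_add h]
  simp

theorem integrable_rpow_sq_add_sq {v : ℝ} (hv : v ≠ 0) {σ : ℝ} (hσ : 1 / 2 < σ) :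
    Integrable fun x : ℝ => (x ^ 2 + v ^ 2) ^ (-σ) := by
  have h := (integrable_rpow_neg_one_add_norm_sq (E := ℝ) (μ := volume) (r := 2 * σ)
    (by simp; linarith)).comp_div (R := v) hv |>.const_mul ((v ^ 2) ^ (-σ))
  refine h.congr (Eventually.of_forall fun x => ?_)
  simp only
  rw [show -(2 * σ) / 2 = -σ by ring, ← Real.mul_rpow (by positivity) (by positivity)]
  congr 1
  rw [Real.norm_eq_abs, sq_abs]
  field_simp
  ring

theorem integrableOn_cpow_mul_cexp_neg {a : ℂ} (ha : 0 < a.re) {r : ℝ} (hr : 0 < r) :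
    IntegrableOn (fun t : ℝ => (t : ℂ) ^ (a - 1) * cexp (-(r * t))) (Ioi 0) := by
  have h := integrableOn_rpow_mul_exp_neg_mul_rpow (s := a.re - 1) (p := 1) (b := r)
    (by linarith) one_pos hr
  refine Integrable.mono' h ?_ ?_
  · exact (by fun_prop : Measurable fun t : ℝ => (t : ℂ) ^ (a - 1) * cexp (-(r * t))).aestronglyMeasurable
  · refine (ae_restrict_iff' measurableSet_Ioi).2 (Eventually.of_forall fun t ht => ?_)
    rw [norm_mul, norm_cpow_eq_rpow_re_of_pos ht, Complex.norm_exp]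
    simp

/-- The integrand of the double integral computing the Fourier transform of `latticeKernel`. -/
def doubleKernel (n : ℕ) (v : ℝ) (s : ℂ) (ξ x t : ℝ) : ℂ :=
  cexp (↑(-2 * Real.pi * x * ξ) * I) * ((x : ℂ) - I * v) ^ (2 * n) *
    ((t : ℂ) ^ (s + n - 1) * cexp (-((Real.pi * (x ^ 2 + v ^ 2) : ℝ) * t)))

/-- Euler's Gamma integral with exponent s + n and rate π(x² + v²). -/
theorem integral_doubleKernel_right (n : ℕ) {v : ℝ} (hv : v ≠ 0) {s : ℂ} (hs : 1 / 2 < s.re)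
    (ξ x : ℝ) :
    ∫ t in Ioi (0 : ℝ), doubleKernel n v s ξ x t =
      (Real.pi : ℂ) ^ (-(s + n)) * Gamma (s + n) *
        (cexp (↑(-2 * Real.pi * x * ξ) * I) • latticeKernel n v s x) := by
  have h : 0 < x ^ 2 + v ^ 2 := by positivity
  unfold doubleKernel latticeKernel
  rw [integral_const_mul, integral_cpow_mul_exp_neg_mul_Ioi
    (by simp; have : (0 : ℝ) ≤ n := n.cast_nonneg; linarith) (by positivity)]
  have : (1 / ((Real.pi * (x ^ 2 + v ^ 2) : ℝ) : ℂ)) ^ (s + n) =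
      (Real.pi : ℂ) ^ (-(s + n)) * ((x ^ 2 + v ^ 2 : ℝ) : ℂ) ^ (-(s + n)) := by
    rw [← mul_cpow_ofReal_nonneg Real.pi_pos.le h.le, ← ofReal_mul, cpow_neg, ← inv_cpow, one_div]
    rw [arg_ofReal_of_nonneg (by positivity)]
    exact Real.pi_pos.ne
  rw [this, smul_eq_mul]
  ring

/-- Integrating the absolute value over t leaves a constant times (x² + v²)^(-Re s), which is
integrable because Re s > 1/2. -/
theorem integrable_doubleKernel (n : ℕ) {v : ℝ} (hv : v ≠ 0) {s : ℂ} (hs : 1 / 2 < s.re) (ξ : ℝ) :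
    Integrable (Function.uncurry (doubleKernel n v s ξ))
      (volume.prod (volume.restrict (Ioi 0))) := by
  have hm : Measurable (Function.uncurry (doubleKernel n v s ξ)) := by
    unfold doubleKernel Function.uncurry
    fun_prop
  have hn : (0 : ℝ) ≤ n := n.cast_nonneg
  rw [integrable_prod_iff hm.aestronglyMeasurable]
  have hpos : ∀ x : ℝ, 0 < x ^ 2 + v ^ 2 := fun x => by positivity
  refine ⟨Eventually.of_forall fun x => ?_, ?_⟩
  · have hpx := hpos x
    have hre : 0 < (s + n).re := by simp; linarith
    exact (integrableOn_cpow_mul_cexp_neg hre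
      (by positivity : 0 < Real.pi * (x ^ 2 + v ^ 2))).const_mul
        (cexp (↑(-2 * Real.pi * x * ξ) * I) * ((x : ℂ) - I * v) ^ (2 * n))
  · refine ((integrable_rpow_sq_add_sq hv hs).const_mul
      ((1 / Real.pi) ^ (s.re + n) * Real.Gamma (s.re + n))).congr (Eventually.of_forall fun x => ?_)
    have hpx := hpos x
    have h1 : ∫ t in Ioi (0 : ℝ), ‖Function.uncurry (doubleKernel n v s ξ) (x, t)‖ =
        ∫ t in Ioi (0 : ℝ), (x ^ 2 + v ^ 2) ^ n *
          (t ^ (s.re + n - 1) * Real.exp (-((Real.pi * (x ^ 2 + v ^ 2)) * t))) := by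
      refine setIntegral_congr_fun measurableSet_Ioi fun t ht => ?_
      simp only [Function.uncurry, doubleKernel]
      rw [norm_mul, norm_mul, norm_mul, norm_pow, pow_mul, norm_sub_I_mul_sq,
        norm_cpow_eq_rpow_re_of_pos ht, Complex.norm_exp_ofReal_mul_I, Complex.norm_exp, one_mul]
      congr 3
      simp only [neg_re, re_ofReal_mul, ofReal_re]
    simp only
    rw [h1, integral_const_mul, Real.integral_rpow_mul_exp_neg_mul_Ioi (by linarith) (by positivity),
      ← one_div_mul_one_div, Real.mul_rpow (by positivity) (by positivity),
      one_div (x ^ 2 + v ^ 2), Real.inv_rpow (by positivity), ← Real.rpow_neg (by positivity)]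
    have : (x ^ 2 + v ^ 2) ^ (-s.re) = (x ^ 2 + v ^ 2) ^ n * (x ^ 2 + v ^ 2) ^ (-(s.re + n)) := by
      rw [← Real.rpow_natCast _ n, ← Real.rpow_add hpx]
      congr 1; ring
    rw [this]; ring

theorem gaussMoment_zero {t : ℝ} (ht : 0 < t) (ξ : ℝ) (p : ℂ) :
    gaussMoment (Real.pi * t) (-2 * Real.pi * ξ * I) p 0 =
      (t : ℂ) ^ (-(1 / 2) : ℂ) * cexp (-(Real.pi * ξ ^ 2 / t)) := by
  unfold gaussMoment
  have hb : (-((Real.pi : ℂ) * t)).re < 0 := by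
    rw [← ofReal_mul, ← ofReal_neg, ofReal_re]; nlinarith [Real.pi_pos]
  have h := integral_cexp_quadratic hb (-2 * Real.pi * ξ * I) 0
  have hpi : (Real.pi : ℂ) ≠ 0 := by exact_mod_cast Real.pi_pos.ne'
  have ht0 : (t : ℂ) ≠ 0 := by exact_mod_cast ht.ne'
  simp only [pow_zero, one_mul, add_zero] at h ⊢
  rw [h, neg_neg, cpow_neg, ← inv_cpow]
  · congr 2
    · field_simp
    · have : I ^ 2 = -1 := I_sq
      field_simp
      rw [this]; ring
  · rw [arg_ofReal_of_nonneg ht.le]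
    exact Real.pi_pos.ne

/-- An even Gaussian moment with b = πt, c = -2πiξ, p = -iv, so that p + c/(2b) = -i(v + ξ/t). The
factor t^(-n) from the moment cancels the t^n of the Mellin weight. -/
theorem integral_doubleKernel_left (n : ℕ) (v : ℝ) (s : ℂ) (ξ : ℝ) {t : ℝ} (ht : 0 < t) :
    ∫ x : ℝ, doubleKernel n v s ξ x t =
      (t : ℂ) ^ (s - 1 / 2 - 1) *
        (Real.exp (-(Real.pi * v ^ 2 * t + Real.pi * ξ ^ 2 / t)) : ℂ) *
      ((4 * Real.pi : ℂ) ^ (-(n : ℤ)) * ∑ l ∈ Finset.range (n + 1),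
        ((2 * n)! / ((n - l)! * (2 * l)!) : ℂ) * (-(4 * Real.pi * t) * (v + ξ / t) ^ 2) ^ l) := by
  have ht0 : (t : ℂ) ≠ 0 := by exact_mod_cast ht.ne'
  have hpi : (Real.pi : ℂ) ≠ 0 := by exact_mod_cast Real.pi_pos.ne'
  have h1 : ∀ x : ℝ, doubleKernel n v s ξ x t =
      ((t : ℂ) ^ (s + n - 1) * cexp (-(Real.pi * v ^ 2 * t))) *
      (((x : ℂ) + (-(I * v))) ^ (2 * n) *
        cexp (-(Real.pi * t) * (x : ℂ) ^ 2 + (-2 * Real.pi * ξ * I) * x)) := by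
    intro x
    unfold doubleKernel
    have : cexp (↑(-2 * Real.pi * x * ξ) * I) * cexp (-((Real.pi * (x ^ 2 + v ^ 2) : ℝ) * t)) =
        cexp (-(Real.pi * v ^ 2 * t)) *
          cexp (-(Real.pi * t) * (x : ℂ) ^ 2 + (-2 * Real.pi * ξ * I) * x) := by
      rw [← Complex.exp_add, ← Complex.exp_add]
      congr 1
      push_cast; ring
    rw [sub_eq_add_neg]
    linear_combination ((x : ℂ) + (-(I * v))) ^ (2 * n) * (t : ℂ) ^ (s + n - 1) * this
  simp_rw [h1]
  rw [integral_const_mul]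
  have hb : 0 < ((Real.pi : ℂ) * t).re := by
    rw [← ofReal_mul, ofReal_re]; positivity
  have h2 := gaussMoment_even hb (-2 * Real.pi * ξ * I) (-(I * v)) n
  rw [gaussMoment_zero ht] at h2
  unfold gaussMoment at h2
  rw [h2]
  have h3 : ∀ l ∈ Finset.range (n + 1),
      ((2 * n)! / ((n - l)! * (2 * l)!) : ℂ) * (1 / (4 * (Real.pi * t))) ^ (n - l) *
        (-(I * v) + -2 * Real.pi * ξ * I / (2 * (Real.pi * t))) ^ (2 * l) =
      (4 * Real.pi : ℂ) ^ (-(n : ℤ)) * (t : ℂ) ^ (-(n : ℤ)) *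
        (((2 * n)! / ((n - l)! * (2 * l)!) : ℂ) * (-(4 * Real.pi * t) * (v + ξ / t) ^ 2) ^ l) := by
    intro l hl
    have hl : l ≤ n := by rw [Finset.mem_range] at hl; omega
    have e1 : (-(I * v) + -2 * Real.pi * ξ * I / (2 * (Real.pi * t)) : ℂ) ^ 2 =
        -(v + ξ / t) ^ 2 := by
      have : (-(I * v) + -2 * Real.pi * ξ * I / (2 * (Real.pi * t)) : ℂ) = -I * (v + ξ / t) := by
        field_simp; ring
      rw [this, mul_pow, neg_sq, I_sq]; ring
    have e2 : (1 / (4 * (Real.pi * t)) : ℂ) ^ (n - l) =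
        (4 * Real.pi : ℂ) ^ (-(n : ℤ)) * (t : ℂ) ^ (-(n : ℤ)) * (4 * Real.pi * t) ^ l := by
      rw [← mul_zpow, zpow_neg, zpow_natCast, ← mul_assoc, one_div, inv_pow]
      have hz : (4 * Real.pi * t : ℂ) ≠ 0 := by simp [hpi, ht0]
      rw [inv_mul_eq_div, eq_div_iff (pow_ne_zero _ hz), inv_mul_eq_div,
        div_eq_iff (pow_ne_zero _ hz), ← pow_add, Nat.add_sub_cancel' hl]
    rw [pow_mul, e1, e2, show -(4 * Real.pi * t : ℂ) * (v + ξ / t) ^ 2 =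
      (4 * Real.pi * t) * (-(v + ξ / t) ^ 2) by ring, mul_pow (4 * Real.pi * t : ℂ) _ l]
    ring
  rw [Finset.sum_congr rfl h3, ← Finset.mul_sum]
  have h4 : (t : ℂ) ^ (s + n - 1) * (t : ℂ) ^ (-(1 / 2) : ℂ) * (t : ℂ) ^ (-(n : ℤ)) =
      (t : ℂ) ^ (s - 1 / 2 - 1) := by
    rw [← cpow_intCast, ← cpow_add _ _ ht0, ← cpow_add _ _ ht0]
    congr 1; push_cast; ring
  have h5 : cexp (-(Real.pi * v ^ 2 * t)) * cexp (-(Real.pi * ξ ^ 2 / t)) =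
      (Real.exp (-(Real.pi * v ^ 2 * t + Real.pi * ξ ^ 2 / t)) : ℂ) := by
    rw [← Complex.exp_add, ofReal_exp]
    congr 1; push_cast; ring
  rw [← h4, ← h5]
  ring

theorem fourier_latticeKernel (n : ℕ) {v : ℝ} (hv : v ≠ 0) {s : ℂ} (hs : 1 / 2 < s.re) (ξ : ℝ) :
    (Real.pi : ℂ) ^ (-(s + n)) * Gamma (s + n) * 𝓕 (latticeKernel n v s) ξ =
      ∫ t in Ioi (0 : ℝ), (t : ℂ) ^ (s - 1 / 2 - 1) *
        (Real.exp (-(Real.pi * v ^ 2 * t + Real.pi * ξ ^ 2 / t)) : ℂ) *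
      ((4 * Real.pi : ℂ) ^ (-(n : ℤ)) * ∑ l ∈ Finset.range (n + 1),
        ((2 * n)! / ((n - l)! * (2 * l)!) : ℂ) * (-(4 * Real.pi * t) * (v + ξ / t) ^ 2) ^ l) := by
  rw [Real.fourier_real_eq_integral_exp_smul, ← integral_const_mul]
  simp_rw [← integral_doubleKernel_right n hv hs ξ]
  rw [integral_integral_swap (integrable_doubleKernel n hv hs ξ)]
  exact setIntegral_congr_fun measurableSet_Ioi fun t ht => integral_doubleKernel_left n v s ξ ht

/-- The Fourier transform of `latticeKernel` at a nonzero frequency. -/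
theorem fourier_latticeKernel_of_ne_zero (n : ℕ) {v : ℝ} (hv : v ≠ 0) {s : ℂ} (hs : 1 / 2 < s.re)
    {ξ : ℝ} (hξ : ξ ≠ 0) :
    (Real.pi : ℂ) ^ (-(s + n)) * Gamma (s + n) * 𝓕 (latticeKernel n v s) ξ =
      (4 * Real.pi : ℂ) ^ (-(n : ℤ)) * ∑ r ∈ Finset.Icc (-(n : ℤ)) n,
        (laguerrePNonneg n r (4 * Real.pi * ξ * v) : ℂ) * ((v / ξ : ℝ) : ℂ) ^ r *
          (((|ξ| / |v| : ℝ) : ℂ) ^ (s - 1 / 2 + r) *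
            (2 * besselK (s - 1 / 2 + r) (2 * Real.pi * (|v| * |ξ|)))) := by
  have hξ0 : (ξ : ℂ) ≠ 0 := by exact_mod_cast hξ
  have hv0 : (v : ℂ) ≠ 0 := by exact_mod_cast hv
  rw [fourier_latticeKernel n hv hs]
  have h1 : ∀ t ∈ Ioi (0 : ℝ), (t : ℂ) ^ (s - 1 / 2 - 1) *
        (Real.exp (-(Real.pi * v ^ 2 * t + Real.pi * ξ ^ 2 / t)) : ℂ) *
      ((4 * Real.pi : ℂ) ^ (-(n : ℤ)) * ∑ l ∈ Finset.range (n + 1),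
        ((2 * n)! / ((n - l)! * (2 * l)!) : ℂ) * (-(4 * Real.pi * t) * (v + ξ / t) ^ 2) ^ l) =
      ∑ r ∈ Finset.Icc (-(n : ℤ)) n, (4 * Real.pi : ℂ) ^ (-(n : ℤ)) *
        (laguerrePNonneg n r (4 * Real.pi * ξ * v) : ℂ) * ((v / ξ : ℝ) : ℂ) ^ r *
        ((t : ℂ) ^ (s - 1 / 2 + r - 1) *
          (Real.exp (-(Real.pi * |v| ^ 2 * t + Real.pi * |ξ| ^ 2 / t)) : ℂ)) := by
    intro t ht
    have ht0 : (t : ℂ) ≠ 0 := by exact_mod_cast (ne_of_gt ht)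
    -- The variable u = tv/ξ satisfies t(v + ξ/t)² = ξv(u + 2 + 1/u), the shape required by the
    -- generating function of the P^n_r.
    have hu : (t * (v / ξ) : ℂ) ≠ 0 := by simp [ht0, hξ0, hv0]
    have h2 := sum_laguerrePNonneg_mul_zpow n (4 * Real.pi * ξ * v) hu
    have h3 : (-(4 * Real.pi * t) * (v + ξ / t) ^ 2 : ℂ) =
        -((4 * Real.pi * ξ * v : ℝ) : ℂ) * (t * (v / ξ) + 2 + (t * (v / ξ) : ℂ)⁻¹) := by
      push_cast
      field_simp
      ring
    rw [h3, ← h2, Finset.mul_sum, Finset.mul_sum, sq_abs, sq_abs]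
    refine Finset.sum_congr rfl fun r _ => ?_
    have h4 : (t : ℂ) ^ (s - 1 / 2 + r - 1) = (t : ℂ) ^ (s - 1 / 2 - 1) * (t : ℂ) ^ r := by
      rw [← cpow_intCast, ← cpow_add _ _ ht0]; congr 1; ring
    rw [h4, mul_zpow (t : ℂ)]
    push_cast
    ring
  rw [setIntegral_congr_fun measurableSet_Ioi h1, integral_finsetSum]
  · rw [Finset.mul_sum]
    refine Finset.sum_congr rfl fun r _ => ?_
    rw [integral_const_mul, integral_cpow_mul_exp_eq_besselK (abs_pos.2 hv) (abs_pos.2 hξ)]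
    ring
  · intro r _
    exact (integrableOn_cpow_mul_exp (abs_pos.2 hv) (abs_pos.2 hξ) _).const_mul _

/-- A form of the duplication formula: rising products from a half-integer are ratios of factorials.
-/
theorem pow_four_mul_prod (l m : ℕ) :
    (4 : ℂ) ^ m * (∏ i ∈ Finset.range m, (1 / 2 + l + i : ℂ)) * ((l + m)! * (2 * l)!) =
      (2 * (l + m))! * l ! := by
  induction m with
  | zero => simp; ring
  | succ m ih =>
    rw [Finset.prod_range_succ, show l + (m + 1) = (l + m) + 1 by ring,
      show 2 * (l + m + 1) = 2 * (l + m) + 1 + 1 by ring, Nat.factorial_succ, Nat.factorial_succ,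
      Nat.factorial_succ]
    push_cast
    linear_combination (4 * (1 / 2 + l + m) * (l + m + 1)) * ih

/-- By `pow_four_mul_prod` the coefficients are binomials times rising products from 1/2 + l, so
this is Chu–Vandermonde with a = 1/2. -/
theorem sum_constant_term (n : ℕ) (w : ℂ) :
    (4 : ℂ) ^ (-(n : ℤ)) * ∑ l ∈ Finset.range (n + 1), ((2 * n)! / ((n - l)! * (2 * l)!) : ℂ) *
      (-4) ^ l * ∏ i ∈ Finset.range l, (w + i) = ∏ i ∈ Finset.range n, (1 / 2 - w + i) := by
  rw [← sum_choose_ascPochhammer n w (1 / 2), Finset.mul_sum]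
  refine Finset.sum_congr rfl fun l hl => ?_
  have hl : l ≤ n := by rw [Finset.mem_range] at hl; omega
  have h := pow_four_mul_prod l (n - l)
  rw [Nat.add_sub_cancel' hl] at h
  have hc := Nat.choose_mul_factorial_mul_factorial hl
  have hc' : (n.choose l : ℂ) * l ! * (n - l)! = n ! := by exact_mod_cast hc
  have h1 : ((n - l)! : ℂ) ≠ 0 := by exact_mod_cast Nat.factorial_ne_zero _
  have h2 : ((2 * l)! : ℂ) ≠ 0 := by exact_mod_cast Nat.factorial_ne_zero _
  have h3 : (l ! : ℂ) ≠ 0 := by exact_mod_cast Nat.factorial_ne_zero _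
  have h5 : (n ! : ℂ) ≠ 0 := by exact_mod_cast Nat.factorial_ne_zero _
  have h6 : (4 : ℂ) ^ n = 4 ^ (n - l) * 4 ^ l := by rw [← pow_add, Nat.sub_add_cancel hl]
  have key : ((2 * n)! / ((n - l)! * (2 * l)!) : ℂ) * 4 ^ l = 4 ^ n * (n.choose l : ℂ) *
      ∏ i ∈ Finset.range (n - l), (1 / 2 + l + i : ℂ) := by
    rw [h6, div_mul_eq_mul_div, div_eq_iff (mul_ne_zero h1 h2)]
    have : (2 * n)! * (l ! : ℂ) * 4 ^ l = (4 ^ (n - l) * 4 ^ l * (n.choose l : ℂ) *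
      (∏ i ∈ Finset.range (n - l), (1 / 2 + l + i : ℂ)) * ((n - l)! * (2 * l)!)) * l ! := by
      rw [← h, ← hc']; ring
    exact mul_right_cancel₀ h3 (by linear_combination this)
  rw [zpow_neg, zpow_natCast, show (-4 : ℂ) ^ l = (-1) ^ l * 4 ^ l by rw [← mul_pow]; norm_num]
  have h4 : (4 : ℂ) ^ n ≠ 0 := pow_ne_zero _ (by norm_num)
  rw [inv_mul_eq_div, div_eq_iff h4]
  linear_combination (-1) ^ l * (∏ i ∈ Finset.range l, (w + i)) * key

theorem Gamma_add_natCast {w : ℂ} (n : ℕ) (hw : ∀ i : ℕ, w + i ≠ 0) :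
    Gamma (w + n) = (∏ i ∈ Finset.range n, (w + i)) * Gamma w := by
  induction n with
  | zero => simp
  | succ n ih =>
    rw [Finset.prod_range_succ, Nat.cast_succ, ← add_assoc, Gamma_add_one _ (hw n), ih]
    ring

/-- The Fourier transform of `latticeKernel` at frequency zero. -/
theorem fourier_latticeKernel_zero (n : ℕ) {v : ℝ} (hv : v ≠ 0) {s : ℂ} (hs : 1 / 2 < s.re) :
    (Real.pi : ℂ) ^ (-(s + n)) * Gamma (s + n) * 𝓕 (latticeKernel n v s) 0 =
      (Real.pi : ℂ) ^ (-(n : ℤ)) * ((1 / (Real.pi * v ^ 2 : ℝ) : ℂ) ^ (s - 1 / 2) *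
        Gamma (s - 1 / 2)) * ∏ i ∈ Finset.range n, (1 - s + i) := by
  have hpos : 0 < Real.pi * v ^ 2 := by positivity
  have hre : 0 < (s - 1 / 2).re := by simp; linarith
  have hw : ∀ i : ℕ, s - 1 / 2 + i ≠ 0 := by
    intro i h
    have := congrArg re h
    simp at this hre
    have hi : (0 : ℝ) ≤ i := i.cast_nonneg
    linarith
  rw [fourier_latticeKernel n hv hs]
  -- At frequency zero every term is a pure power of t times an exponential, so it integrates to a
  -- multiple of Γ(s - 1/2 + l). The sum is then `sum_constant_term` with w = s - 1/2, where 1/2 - w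
  -- = 1 - s.
  have h1 : ∀ t ∈ Ioi (0 : ℝ), (t : ℂ) ^ (s - 1 / 2 - 1) *
        (Real.exp (-(Real.pi * v ^ 2 * t + Real.pi * (0 : ℝ) ^ 2 / t)) : ℂ) *
      ((4 * Real.pi : ℂ) ^ (-(n : ℤ)) * ∑ l ∈ Finset.range (n + 1),
        ((2 * n)! / ((n - l)! * (2 * l)!) : ℂ) *
          (-(4 * Real.pi * t) * (v + (0 : ℝ) / t) ^ 2) ^ l) =
      ∑ l ∈ Finset.range (n + 1), (4 * Real.pi : ℂ) ^ (-(n : ℤ)) *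
        ((2 * n)! / ((n - l)! * (2 * l)!) : ℂ) * (-4 * ((Real.pi * v ^ 2 : ℝ) : ℂ)) ^ l *
        ((t : ℂ) ^ (s - 1 / 2 + l - 1) * cexp (-((Real.pi * v ^ 2 : ℝ) * t))) := by
    intro t ht
    have ht0 : (t : ℂ) ≠ 0 := by exact_mod_cast (ne_of_gt ht)
    rw [Finset.mul_sum, Finset.mul_sum]
    refine Finset.sum_congr rfl fun l _ => ?_
    have h4 : (t : ℂ) ^ (s - 1 / 2 + l - 1) = (t : ℂ) ^ (s - 1 / 2 - 1) * (t : ℂ) ^ l := by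
      rw [← cpow_natCast, ← cpow_add _ _ ht0]; congr 1; ring
    have h5 : (-(4 * Real.pi * t) * (v + (0 : ℝ) / t) ^ 2 : ℂ) ^ l =
        (-4 * ((Real.pi * v ^ 2 : ℝ) : ℂ)) ^ l * (t : ℂ) ^ l := by
      rw [← mul_pow]; congr 1; push_cast; ring
    rw [h4, h5, ofReal_exp]
    have : cexp ((-(Real.pi * v ^ 2 * t + Real.pi * (0 : ℝ) ^ 2 / t) : ℝ) : ℂ) =
        cexp (-((Real.pi * v ^ 2 : ℝ) * t)) := by
      congr 1; push_cast; ring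
    rw [this]
    ring
  rw [setIntegral_congr_fun measurableSet_Ioi h1, integral_finsetSum]
  · have h2 : ∀ l ∈ Finset.range (n + 1), ∫ t in Ioi (0 : ℝ), (4 * Real.pi : ℂ) ^ (-(n : ℤ)) *
        ((2 * n)! / ((n - l)! * (2 * l)!) : ℂ) * (-4 * ((Real.pi * v ^ 2 : ℝ) : ℂ)) ^ l *
        ((t : ℂ) ^ (s - 1 / 2 + l - 1) * cexp (-((Real.pi * v ^ 2 : ℝ) * t))) =
        (Real.pi : ℂ) ^ (-(n : ℤ)) * ((1 / (Real.pi * v ^ 2 : ℝ) : ℂ) ^ (s - 1 / 2) *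
        Gamma (s - 1 / 2)) * ((4 : ℂ) ^ (-(n : ℤ)) * (((2 * n)! / ((n - l)! * (2 * l)!) : ℂ) *
          (-4) ^ l * ∏ i ∈ Finset.range l, (s - 1 / 2 + i))) := by
      intro l _
      have hne : ((Real.pi * v ^ 2 : ℝ) : ℂ) ≠ 0 := by exact_mod_cast hpos.ne'
      have hl : (0 : ℝ) ≤ l := l.cast_nonneg
      rw [integral_const_mul, integral_cpow_mul_exp_neg_mul_Ioi (by rw [add_re, natCast_re]; linarith)
        hpos, Gamma_add_natCast l hw, cpow_add _ _ (one_div_ne_zero hne), cpow_natCast, mul_zpow,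
        mul_pow, one_div, inv_pow]
      field_simp
    rw [Finset.sum_congr rfl h2, ← Finset.mul_sum, ← Finset.mul_sum, sum_constant_term n (s - 1 / 2)]
    congr 1
    refine Finset.prod_congr rfl fun i _ => ?_
    ring
  · intro l _
    have hl : (0 : ℝ) ≤ l := l.cast_nonneg
    exact (integrableOn_cpow_mul_cexp_neg (by rw [add_re, natCast_re]; linarith) hpos).const_mul _

end NonholomorphicEisenstein
end

/-! ### The function θ_k, its functional equation and the constant term -/

noncomputable section

namespace NonholomorphicEisenstein

open Complex Set Filter

/-- The integers are closed and discrete. The punctured limit defining `theta` may therefore be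
computed away from the poles of Γ. -/
theorem eventually_add_natCast_ne_zero (s : ℂ) : ∀ᶠ w : ℂ in 𝓝[≠] s, ∀ i : ℕ, w + i ≠ 0 := by
  by_cases hs : s ∈ range (fun n : ℤ => (n : ℂ))
  · obtain ⟨m, rfl⟩ := hs
    have h : Metric.ball (m : ℂ) 1 ∈ 𝓝 (m : ℂ) := Metric.ball_mem_nhds _ one_pos
    filter_upwards [mem_nhdsWithin_of_mem_nhds h, self_mem_nhdsWithin] with w hw hne i hi
    have hwi : w = ((-(i : ℤ) : ℤ) : ℂ) := by push_cast; exact eq_neg_of_add_eq_zero_left hi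
    rw [hwi, Metric.mem_ball, dist_eq_norm, ← Int.cast_sub, Complex.norm_intCast] at hw
    have h2 : |(-(i : ℤ) - m : ℤ)| < 1 := by exact_mod_cast hw
    rw [Int.abs_lt_one_iff] at h2
    exact hne (by rw [hwi, mem_singleton_iff]; congr 1; omega)
  · have h : (range (fun n : ℤ => (n : ℂ)))ᶜ ∈ 𝓝 s :=
      Complex.isClosed_range_intCast.isOpen_compl.mem_nhds hs
    filter_upwards [mem_nhdsWithin_of_mem_nhds h] with w hw i hi
    exact hw ⟨-(i : ℤ), by push_cast; exact (eq_neg_of_add_eq_zero_left hi).symm⟩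

/-- The polynomial `s (s + 1) ⋯ (s + n - 1)`. -/
def risingProd (n : ℕ) (s : ℂ) : ℂ := ∏ i ∈ Finset.range n, (s + i)

theorem differentiable_risingProd (n : ℕ) : Differentiable ℂ (risingProd n) := by
  unfold risingProd
  fun_prop

/-- The quotient `risingProd n s / s`. -/
def risingProdDiv (n : ℕ) (s : ℂ) : ℂ :=
  if n = 0 then s⁻¹ else ∏ i ∈ Finset.range (n - 1), (s + (i + 1 : ℕ))

theorem risingProdDiv_eq (n : ℕ) {s : ℂ} (hs : s ≠ 0) : risingProdDiv n s = risingProd n s / s := by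
  unfold risingProdDiv risingProd
  rcases n with _ | n
  · simp
  · rw [if_neg n.succ_ne_zero, Finset.prod_range_succ']
    simp [hs]

theorem differentiable_risingProdDiv {n : ℕ} (hn : n ≠ 0) : Differentiable ℂ (risingProdDiv n) := by
  unfold risingProdDiv
  simp only [hn, if_false]
  fun_prop

theorem continuousAt_risingProdDiv {n : ℕ} {s : ℂ} (h : n = 0 → s ≠ 0) :
    ContinuousAt (risingProdDiv n) s := by
  by_cases hn : n = 0
  · have : risingProdDiv n = fun w => w⁻¹ := by ext w; simp [risingProdDiv, hn]
    rw [this]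
    exact continuousAt_inv₀ (h hn)
  · exact (differentiable_risingProdDiv hn).continuous.continuousAt

/-- The part of `theta` that is regular at `s = 1/2`. -/
def thetaRegular (n : ℕ) (s : ℂ) : ℂ :=
  completedRiemannZeta₀ (2 * s) * risingProd n s - risingProdDiv n s / 2

/-- Λ(2s) equals an entire function minus 1/(2s) minus 1/(1 - 2s); the last fraction is kept apart
as the polar part at 1/2. -/
theorem theta_regular_eq (n : ℕ) {s : ℂ} (h0 : s ≠ 0) :
    completedRiemannZeta (2 * s) * risingProd n s =
      thetaRegular n s - risingProd n s / (1 - 2 * s) := by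
  unfold thetaRegular
  rw [completedRiemannZeta_eq, risingProdDiv_eq n h0]
  field_simp

/-- Γ(w + n) is the rising product times Γ(w), and π^(-w) Γ(w) ζ(2w) is the completed zeta function
at 2w. -/
theorem theta_integrand_eq (n : ℕ) {w : ℂ} (hw : ∀ i : ℕ, w + i ≠ 0) :
    (Real.pi : ℂ) ^ (-w) * Gamma (w + n) * riemannZeta (2 * w) =
      completedRiemannZeta (2 * w) * risingProd n w := by
  have hpi : (Real.pi : ℂ) ≠ 0 := by exact_mod_cast Real.pi_pos.ne'
  have h0 : w ≠ 0 := by simpa using hw 0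
  have hG : Gamma w ≠ 0 := Gamma_ne_zero fun i hi => hw i (by rw [hi]; ring)
  have hp : (Real.pi : ℂ) ^ (-w) ≠ 0 := by simp [cpow_eq_zero_iff, hpi]
  rw [riemannZeta_def_of_ne_zero (by simpa using h0), Gammaℝ_def, Gamma_add_natCast n hw]
  rw [show -(2 * w) / 2 = -w by ring, show 2 * w / 2 = w by ring]
  unfold risingProd
  field_simp

theorem theta_of_continuousAt {k : ℤ} {n : ℕ} (hk : |k| = 2 * n) {s : ℂ} {f : ℂ → ℂ}
    (hf : ContinuousAt f s) (h : ∀ᶠ w in 𝓝[≠] s,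
      (Real.pi : ℂ) ^ (-w) * Gamma (w + n) * riemannZeta (2 * w) = f w) :
    theta k s = f s := by
  unfold theta
  apply Tendsto.limUnder_eq
  refine (hf.tendsto.mono_left nhdsWithin_le_nhds).congr' ?_
  filter_upwards [h] with w hw
  rw [← hw, hk]
  push_cast
  congr 4
  ring

theorem theta_eq {k : ℤ} {n : ℕ} (hk : |k| = 2 * n) {s : ℂ} (h : s ≠ 1 / 2) (h0 : n = 0 → s ≠ 0) :
    theta k s = thetaRegular n s - risingProd n s / (1 - 2 * s) := by
  have h2 : 1 - 2 * s ≠ 0 := by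
    intro h'; apply h; linear_combination -h' / 2
  refine theta_of_continuousAt hk (f := fun s => thetaRegular n s - risingProd n s / (1 - 2 * s))
    ?_ ?_
  · have h1 : ContinuousAt (risingProd n) s := (differentiable_risingProd n).continuous.continuousAt
    have h3 : ContinuousAt (fun s => completedRiemannZeta₀ (2 * s)) s :=
      (differentiable_completedZeta₀.continuous.comp (continuous_const.mul continuous_id)).continuousAt
    refine ContinuousAt.sub ?_ (h1.div (by fun_prop) h2)
    exact (h3.mul h1).sub ((continuousAt_risingProdDiv h0).div_const 2)
  · filter_upwards [eventually_add_natCast_ne_zero s] with w hw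
    rw [theta_integrand_eq n hw, theta_regular_eq n (by simpa using hw 0)]

theorem theta_of_one_lt_re {k : ℤ} {n : ℕ} (hk : |k| = 2 * n) {s : ℂ} (hs : 1 < s.re) :
    theta k s = (Real.pi : ℂ) ^ (-s) * Gamma (s + n) * riemannZeta (2 * s) := by
  have hi : ∀ i : ℕ, s + i ≠ 0 := by
    intro i h
    have := congrArg re h
    simp at this
    have hi : (0 : ℝ) ≤ i := i.cast_nonneg
    linarith
  rw [theta_eq hk, theta_integrand_eq n hi, theta_regular_eq n (by simpa using hi 0)]
  · rintro rfl; norm_num at hs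
  · rintro - rfl; norm_num at hs

/-- The functional equation Λ(2 - 2s) = Λ(2s - 1) leads to an argument where ζ is given by its
series. -/
theorem theta_one_sub_of_one_lt_re {k : ℤ} {n : ℕ} (hk : |k| = 2 * n) {s : ℂ} (hs : 1 < s.re) :
    theta k (1 - s) = (Real.pi : ℂ) ^ (-(s - 1 / 2)) * Gamma (s - 1 / 2) * riemannZeta (2 * s - 1) *
      ∏ i ∈ Finset.range n, (1 - s + i) := by
  have hpi : (Real.pi : ℂ) ≠ 0 := by exact_mod_cast Real.pi_pos.ne'
  have h1 : 1 - s ≠ 0 := by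
    intro h
    have := congrArg re h
    simp at this
    linarith
  have h2 : 1 - s ≠ 1 / 2 := by
    intro h
    have := congrArg re h
    simp at this
    linarith
  have h3 : 2 * s - 1 ≠ 0 := by
    intro h
    have := congrArg re h
    simp at this
    linarith
  have hG : Gamma (s - 1 / 2) ≠ 0 := Gamma_ne_zero_of_re_pos (by simp; linarith)
  have hp : (Real.pi : ℂ) ^ (-(s - 1 / 2)) ≠ 0 := by simp [cpow_eq_zero_iff, hpi]
  rw [theta_eq hk h2 (fun _ => h1), ← theta_regular_eq n h1,
    show 2 * (1 - s) = 1 - (2 * s - 1) by ring, completedRiemannZeta_one_sub,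
    riemannZeta_def_of_ne_zero h3, Gammaℝ_def, show -(2 * s - 1) / 2 = -(s - 1 / 2) by ring,
    show (2 * s - 1) / 2 = s - 1 / 2 by ring]
  unfold risingProd
  generalize Gamma (s - 1 / 2) = G at hG ⊢
  generalize (Real.pi : ℂ) ^ (-(s - 1 / 2)) = P at hp ⊢
  field_simp

/-- The constant term `θ_k(s) y^s + θ_k(1 - s) y^(1 - s)` with its singularity at `1/2` removed. -/
def constantTerm (n : ℕ) (y : ℝ) (s : ℂ) : ℂ :=
  thetaRegular n s * (y : ℂ) ^ s + thetaRegular n (1 - s) * (y : ℂ) ^ (1 - s) +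
    1 / 2 * dslope (fun w => risingProd n w * (y : ℂ) ^ w -
      risingProd n (1 - w) * (y : ℂ) ^ (1 - w)) (1 / 2) s

/-- With R the rising product, the two polar parts add up to (R(s) y^s - R(1-s) y^(1-s)) / (2(s -
1/2)). The numerator vanishes at 1/2, so this is half a difference quotient. -/
theorem constantTerm_eq {k : ℤ} {n : ℕ} (hk : |k| = 2 * n) (y : ℝ) {s : ℂ} (h : s ≠ 1 / 2)
    (h0 : n = 0 → s ≠ 0 ∧ s ≠ 1) :
    constantTerm n y s = theta k s * (y : ℂ) ^ s + theta k (1 - s) * (y : ℂ) ^ (1 - s) := by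
  have h1 : 1 - s ≠ 1 / 2 := by intro h'; apply h; linear_combination -h'
  have h2 : s - 1 / 2 ≠ 0 := sub_ne_zero.2 h
  rw [theta_eq hk h fun hn => (h0 hn).1,
    theta_eq hk h1 fun hn => sub_ne_zero.2 (h0 hn).2.symm, constantTerm, dslope_of_ne _ h, slope]
  have h3 : (1 - 1 / 2 : ℂ) = 1 / 2 := by norm_num
  simp only [h3, vsub_eq_sub, sub_self, sub_zero, smul_eq_mul]
  have h4 : 1 - 2 * s = -2 * (s - 1 / 2) := by ring
  have h5 : 1 - 2 * (1 - s) = 2 * (s - 1 / 2) := by ring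
  rw [h4, h5]
  field_simp
  ring

theorem differentiable_cpow_ofReal {y : ℝ} (hy : 0 < y) : Differentiable ℂ fun s : ℂ => (y : ℂ) ^ s := by
  intro s
  exact (differentiableAt_id).const_cpow (Or.inl (by exact_mod_cast hy.ne'))

theorem differentiable_dslope_part (n : ℕ) {y : ℝ} (hy : 0 < y) :
    Differentiable ℂ (dslope (fun w => risingProd n w * (y : ℂ) ^ w -
      risingProd n (1 - w) * (y : ℂ) ^ (1 - w)) (1 / 2)) := by
  have h1 := (differentiable_risingProd n).mul (differentiable_cpow_ofReal hy)
  have h2 := h1.comp ((differentiable_const (1 : ℂ)).sub differentiable_id)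
  have h3 : Differentiable ℂ (fun w => risingProd n w * (y : ℂ) ^ w -
      risingProd n (1 - w) * (y : ℂ) ^ (1 - w)) := h1.sub h2
  rw [← differentiableOn_univ]
  exact (differentiableOn_dslope univ_mem).2 h3.differentiableOn

theorem differentiable_constantTerm {n : ℕ} (hn : n ≠ 0) {y : ℝ} (hy : 0 < y) :
    Differentiable ℂ (constantTerm n y) := by
  have h1 : Differentiable ℂ (thetaRegular n) :=
    ((differentiable_completedZeta₀.comp (by fun_prop)).mul (differentiable_risingProd n)).sub
      ((differentiable_risingProdDiv hn).div_const 2)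
  have h2 := h1.mul (differentiable_cpow_ofReal hy)
  exact (h2.add (h2.comp ((differentiable_const (1 : ℂ)).sub differentiable_id))).add
    ((differentiable_dslope_part n hy).const_mul _)

theorem meromorphic_constantTerm (n : ℕ) {y : ℝ} (hy : 0 < y) : Meromorphic (constantTerm n y) := by
  have hd : ∀ {f : ℂ → ℂ}, Differentiable ℂ f → Meromorphic f :=
    fun hf x => (hf.analyticAt x).meromorphicAt
  -- For n = 0 the quotient `risingProdDiv` is 1/s, which gives poles at 0 and 1; otherwise
  -- everything is entire.
  by_cases hn : n = 0
  · have h1 : Differentiable ℂ fun s => completedRiemannZeta₀ (2 * s) * risingProd n s :=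
      (differentiable_completedZeta₀.comp (by fun_prop)).mul (differentiable_risingProd n)
    have hid : Differentiable ℂ fun s : ℂ => 1 - s :=
      (differentiable_const (1 : ℂ)).sub differentiable_id
    have hq : Meromorphic fun s : ℂ => risingProdDiv n s / 2 := by
      have : (fun s : ℂ => risingProdDiv n s / 2) = (fun s => s)⁻¹ * fun _ => (2 : ℂ)⁻¹ := by
        ext s; simp [risingProdDiv, hn, div_eq_mul_inv]
      rw [this]
      exact (hd differentiable_id).inv.mul (Meromorphic.const _)
    have hq' : Meromorphic fun s : ℂ => risingProdDiv n (1 - s) / 2 := by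
      have : (fun s : ℂ => risingProdDiv n (1 - s) / 2) = (fun s => 1 - s)⁻¹ * fun _ => (2 : ℂ)⁻¹ := by
        ext s; simp [risingProdDiv, hn, div_eq_mul_inv]
      rw [this]
      exact (hd hid).inv.mul (Meromorphic.const _)
    have hy1 := differentiable_cpow_ofReal hy
    have m1 : Meromorphic fun s => thetaRegular n s * (y : ℂ) ^ s := ((hd h1).sub hq).mul (hd hy1)
    have m2 : Meromorphic fun s => thetaRegular n (1 - s) * (y : ℂ) ^ (1 - s) :=
      ((hd (h1.comp hid)).sub hq').mul (hd (hy1.comp hid))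
    exact (m1.add m2).add ((hd ((differentiable_dslope_part n hy).const_mul (1 / 2))))
  · exact hd (differentiable_constantTerm hn hy)

end NonholomorphicEisenstein
end

/-! ### Bounds for the Fourier terms and normal convergence -/

noncomputable section

namespace NonholomorphicEisenstein

open Complex Set Filter

theorem exists_abs_laguerrePNonneg_le (n : ℕ) (r : ℤ) :
    ∃ D : ℝ, 0 ≤ D ∧ ∀ x : ℝ, |laguerrePNonneg n r x| ≤ D * (1 + |x|) ^ n := by
  refine ⟨∑ l ∈ Finset.Icc |r| n, ((2 * (n : ℤ)).toNat ! : ℝ) /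
    (((n - l).toNat ! : ℝ) * ((l + r).toNat ! : ℝ) * ((l - r).toNat ! : ℝ)),
    Finset.sum_nonneg fun l _ => by positivity, fun x => ?_⟩
  unfold laguerrePNonneg
  rw [Finset.sum_mul]
  refine (Finset.abs_sum_le_sum_abs _ _).trans (Finset.sum_le_sum fun l hl => ?_)
  rw [Finset.mem_Icc] at hl
  rw [abs_mul, abs_pow, abs_neg]
  rw [abs_of_nonneg (by positivity)]
  gcongr
  calc |x| ^ l.toNat ≤ (1 + |x|) ^ l.toNat := by gcongr; linarith
    _ ≤ (1 + |x|) ^ n := by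
      gcongr
      · linarith [abs_nonneg x]
      · omega

theorem exists_abs_laguerreP_le {k : ℤ} {n : ℕ} (hk : |k| = 2 * n) :
    ∃ D : ℝ, 0 ≤ D ∧ ∀ r ∈ Finset.Icc (-(|k| / 2)) (|k| / 2), ∀ x : ℝ,
      |laguerreP (k / 2) r x| ≤ D * (1 + |x|) ^ n := by
  choose D hD0 hD using exists_abs_laguerrePNonneg_le n
  refine ⟨∑ r ∈ Finset.Icc (-(|k| / 2)) (|k| / 2), D r,
    Finset.sum_nonneg fun r _ => hD0 r, fun r hr x => ?_⟩
  have h1 : |laguerreP (k / 2) r x| ≤ D r * (1 + |x|) ^ n := by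
    unfold laguerreP
    split_ifs with h
    · have : k / 2 = n := by
        rcases abs_cases k with h' | h' <;> omega
      rw [this]; exact hD r x
    · have : -(k / 2) = n := by
        rcases abs_cases k with h' | h' <;> omega
      rw [this, abs_mul, abs_zpow]
      simpa using hD r (-x)
  refine h1.trans ?_
  gcongr
  exact Finset.single_le_sum (f := D) (fun r _ => hD0 r) hr

/-- The archimedean factor of the Fourier coefficients. -/
def besselSum (k m : ℤ) (z : UpperHalfPlane) (s : ℂ) : ℂ :=
  ∑ r ∈ Finset.Icc (-(|k| / 2)) (|k| / 2),
    ((m : ℂ) / (m.natAbs : ℂ)) ^ r * (laguerreP (k / 2) r (4 * Real.pi * m * z.im) : ℂ) *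
      whittakerW (s + r) ((m : ℂ) * (z : ℂ))

theorem im_intCast_mul (m : ℤ) (z : UpperHalfPlane) : ((m : ℂ) * (z : ℂ)).im = m * z.im := by
  simp

theorem norm_intCast_div_natAbs {m : ℤ} (hm : m ≠ 0) : ‖(m : ℂ) / (m.natAbs : ℂ)‖ = 1 := by
  have h : (m.natAbs : ℝ) = |(m : ℝ)| := by rw [Nat.cast_natAbs, Int.cast_abs]
  rw [norm_div, Complex.norm_intCast, Complex.norm_natCast, h, div_self]
  simpa using hm

/-- The polynomials grow at most like |m|^n, the square root at most like |m|, and e^(-y/2) at y =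
2π|m| Im z is at most e^(-π y₀ |m|). -/
theorem exists_norm_besselSum_le {k : ℤ} {n : ℕ} (hk : |k| = 2 * n) (A Y : ℝ) {y₀ : ℝ} (hy₀ : 0 < y₀) :
    ∃ C : ℝ, 0 ≤ C ∧ ∀ (m : ℤ) (z : UpperHalfPlane) (s : ℂ), m ≠ 0 → |s.re| ≤ A → y₀ ≤ z.im →
      z.im ≤ Y → ‖besselSum k m z s‖ ≤
        C * ((m.natAbs : ℝ) ^ (n + 1) * Real.exp (-(Real.pi * y₀)) ^ m.natAbs) := by
  obtain ⟨D, hD0, hD⟩ := exists_abs_laguerreP_le hk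
  -- The Bessel indices are s + r - 1/2 with |r| ≤ n, and the arguments are at least 2πy₀ because
  -- |m| ≥ 1.
  obtain ⟨C, hC0, hC⟩ := exists_norm_besselK_le (A + n + 1) (y₀ := 2 * Real.pi * y₀) (by positivity)
  refine ⟨∑ r ∈ Finset.Icc (-(|k| / 2)) (|k| / 2),
    D * (1 + 4 * Real.pi * |Y|) ^ n * (2 * (1 + |Y|)) * C,
    Finset.sum_nonneg fun _ _ => by positivity, fun m z s hm hs hy hY => ?_⟩
  unfold besselSum
  rw [Finset.sum_mul]
  refine (norm_sum_le _ _).trans (Finset.sum_le_sum fun r hr => ?_)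
  have hN : (m.natAbs : ℝ) = |(m : ℝ)| := by rw [Nat.cast_natAbs, Int.cast_abs]
  have hN1 : 1 ≤ |(m : ℝ)| := by
    rw [← hN]; exact_mod_cast Nat.one_le_iff_ne_zero.2 (Int.natAbs_ne_zero.2 hm)
  have hzpos := z.im_pos
  have hYa : z.im ≤ |Y| := hY.trans (le_abs_self Y)
  rw [norm_mul, norm_mul, norm_zpow, norm_intCast_div_natAbs hm, one_zpow, one_mul,
    Complex.norm_real, Real.norm_eq_abs, ← Real.exp_nat_mul, hN]
  have h1 : |laguerreP (k / 2) r (4 * Real.pi * m * z.im)| ≤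
      D * (1 + 4 * Real.pi * |Y|) ^ n * |(m : ℝ)| ^ n := by
    refine (hD r hr _).trans ?_
    rw [mul_assoc D, ← mul_pow]
    gcongr
    rw [abs_mul, abs_mul, abs_of_pos (by positivity : 0 < 4 * Real.pi), abs_of_pos hzpos]
    have : 4 * Real.pi * |(m : ℝ)| * z.im ≤ 4 * Real.pi * |(m : ℝ)| * |Y| := by gcongr
    nlinarith
  have h2 : ‖whittakerW (s + r) ((m : ℂ) * (z : ℂ))‖ ≤
      2 * (1 + |Y|) * C * (|(m : ℝ)| * Real.exp (|(m : ℝ)| * -(Real.pi * y₀))) := by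
    unfold whittakerW
    rw [im_intCast_mul, abs_mul, abs_of_pos hzpos]
    have e1 : ‖cexp (2 * Real.pi * I * ((m : ℂ) * (z : ℂ)).re)‖ = 1 := by
      rw [show (2 * Real.pi * I * (((m : ℂ) * (z : ℂ)).re : ℝ) : ℂ) =
        ((2 * Real.pi * ((m : ℂ) * (z : ℂ)).re : ℝ) : ℂ) * I by push_cast; ring,
        Complex.norm_exp_ofReal_mul_I]
    rw [norm_mul, norm_mul, norm_mul, e1, mul_one, Complex.norm_real, Real.norm_eq_abs,
      abs_of_nonneg (Real.sqrt_nonneg _)]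
    have e2 : Real.sqrt (|(m : ℝ)| * z.im) ≤ (1 + |Y|) * |(m : ℝ)| := by
      rw [Real.sqrt_le_left (by positivity)]
      have : |(m : ℝ)| * z.im ≤ |(m : ℝ)| * |Y| := by gcongr
      nlinarith [mul_nonneg (abs_nonneg Y) (abs_nonneg (m : ℝ)), abs_nonneg Y]
    have e3 := hC (s + r - 1 / 2) (2 * Real.pi * (|(m : ℝ)| * z.im)) (by
      rw [Finset.mem_Icc] at hr
      have hr1 : (-n : ℤ) ≤ r := by omega
      have hr2 : r ≤ (n : ℤ) := by omega
      have hr3 : (-n : ℝ) ≤ r := by exact_mod_cast hr1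
      have hr4 : (r : ℝ) ≤ n := by exact_mod_cast hr2
      rw [abs_le] at hs ⊢
      simp
      constructor <;> linarith) (by
      have : y₀ ≤ |(m : ℝ)| * z.im := by nlinarith
      gcongr)
    have e4 : Real.exp (-(2 * Real.pi * (|(m : ℝ)| * z.im)) / 2) ≤
        Real.exp (|(m : ℝ)| * -(Real.pi * y₀)) := by
      apply Real.exp_le_exp.2
      have : |(m : ℝ)| * y₀ ≤ |(m : ℝ)| * z.im := by gcongr
      nlinarith [Real.pi_pos]
    calc _ ≤ ‖(2 : ℂ)‖ * ((1 + |Y|) * |(m : ℝ)|) *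
          (C * Real.exp (|(m : ℝ)| * -(Real.pi * y₀))) := by
            gcongr
            exact e3.trans (by gcongr)
      _ = _ := by norm_num; ring
  calc _ ≤ _ := mul_le_mul h1 h2 (norm_nonneg _) (by positivity)
    _ = _ := by ring

/-- Crude count: at most N divisors, each contributing at most N^(2A+1), and a factor N^A from the
denominator. The norms stand inside the sum so that the bound also justifies rearranging over
divisors. -/
theorem sum_norm_divisors_div_le {A : ℝ} {s : ℂ} (hs : |s.re| ≤ A) {N : ℕ} (hN : N ≠ 0) :
    (∑ d ∈ N.divisors, ‖(d : ℂ) ^ (2 * s - 1)‖) / ‖(N : ℂ) ^ s‖ ≤ (N : ℝ) ^ (⌈3 * A⌉₊ + 2) := by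
  have hN1 : (1 : ℝ) ≤ N := by exact_mod_cast Nat.one_le_iff_ne_zero.2 hN
  have hN0 : (0 : ℝ) < N := by linarith
  rw [abs_le] at hs
  have h1 : ∑ d ∈ N.divisors, ‖(d : ℂ) ^ (2 * s - 1)‖ ≤ N * (N : ℝ) ^ (2 * A + 1) := by
    calc _ ≤ ∑ d ∈ N.divisors, (N : ℝ) ^ (2 * A + 1) := by
          refine Finset.sum_le_sum fun d hd => ?_
          have hd0 := Nat.pos_of_mem_divisors hd
          have hdN := Nat.divisor_le hd
          rw [norm_natCast_cpow_of_pos hd0]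
          calc _ ≤ (d : ℝ) ^ (2 * A + 1) := by
                apply Real.rpow_le_rpow_of_exponent_le (by exact_mod_cast hd0)
                simp; linarith
            _ ≤ _ := by
                apply Real.rpow_le_rpow (by positivity) (by exact_mod_cast hdN)
                linarith
      _ = N.divisors.card * (N : ℝ) ^ (2 * A + 1) := by simp
      _ ≤ _ := by gcongr; exact Nat.card_divisors_le_self N
  rw [norm_natCast_cpow_of_pos (Nat.pos_of_ne_zero hN), div_eq_mul_inv, ← Real.rpow_neg hN0.le]
  calc _ ≤ N * (N : ℝ) ^ (2 * A + 1) * (N : ℝ) ^ A := by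
        gcongr
        linarith
    _ = (N : ℝ) ^ (1 + (2 * A + 1) + A) := by
        rw [Real.rpow_add hN0 _ A, Real.rpow_add hN0 1, Real.rpow_one]
    _ ≤ (N : ℝ) ^ ((⌈3 * A⌉₊ + 2 : ℕ) : ℝ) := by
        apply Real.rpow_le_rpow_of_exponent_le hN1
        push_cast
        linarith [Nat.le_ceil (3 * A)]
    _ = _ := Real.rpow_natCast _ _

theorem summable_natAbs_pow_mul_geometric (L : ℕ) {q : ℝ} (hq0 : 0 ≤ q) (hq : q < 1) :
    Summable fun m : {m : ℤ // m ≠ 0} => (m.1.natAbs : ℝ) ^ L * q ^ m.1.natAbs := by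
  have h := summable_pow_mul_geometric_of_norm_lt_one (R := ℝ) L (r := q)
    (by rwa [Real.norm_eq_abs, abs_of_nonneg hq0])
  have h2 : Summable fun m : ℤ => (m.natAbs : ℝ) ^ L * q ^ m.natAbs :=
    Summable.of_nat_of_neg (by simpa using h) (by simpa using h)
  exact h2.subtype _

/-- A summable bound for the Fourier terms, locally uniform in `z` and `s`. -/
theorem exists_summable_bound {k : ℤ} {n : ℕ} (hk : |k| = 2 * n) (A Y : ℝ) {y₀ : ℝ} (hy₀ : 0 < y₀) :
    ∃ u : {m : ℤ // m ≠ 0} → ℝ, Summable u ∧ ∀ (m : {m : ℤ // m ≠ 0}) (z : UpperHalfPlane) (s : ℂ),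
      |s.re| ≤ A → y₀ ≤ z.im → z.im ≤ Y →
        (∑ d ∈ m.1.natAbs.divisors, ‖(d : ℂ) ^ (2 * s - 1)‖) / ‖(m.1.natAbs : ℂ) ^ s‖ *
          ‖besselSum k m.1 z s‖ ≤ u m := by
  obtain ⟨C, hC0, hC⟩ := exists_norm_besselSum_le hk A Y hy₀
  refine ⟨_, (summable_natAbs_pow_mul_geometric (⌈3 * A⌉₊ + 2 + (n + 1))
    (Real.exp_pos (-(Real.pi * y₀))).le (by
      rw [Real.exp_lt_one_iff]; nlinarith [Real.pi_pos])).mul_left C, fun m z s hs hy hY => ?_⟩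
  calc _ ≤ _ := mul_le_mul (sum_norm_divisors_div_le hs (Int.natAbs_ne_zero.2 m.2))
        (hC m.1 z s m.2 hs hy hY) (norm_nonneg _) (by positivity)
    _ = _ := by rw [pow_add]; ring

theorem fourierTerm_eq (k : ℤ) (m : {m : ℤ // m ≠ 0}) (z : UpperHalfPlane) (s : ℂ) :
    fourierTerm k m z s =
      sigma (2 * s - 1) m.1.natAbs / (m.1.natAbs : ℂ) ^ s * besselSum k m.1 z s := rfl

theorem exists_summable_bound_fourierTerm {k : ℤ} {n : ℕ} (hk : |k| = 2 * n) (A Y : ℝ) {y₀ : ℝ}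
    (hy₀ : 0 < y₀) :
    ∃ u : {m : ℤ // m ≠ 0} → ℝ, Summable u ∧ ∀ (m : {m : ℤ // m ≠ 0}) (z : UpperHalfPlane) (s : ℂ),
      |s.re| ≤ A → y₀ ≤ z.im → z.im ≤ Y → ‖fourierTerm k m z s‖ ≤ u m := by
  obtain ⟨u, hu, hub⟩ := exists_summable_bound hk A Y hy₀
  refine ⟨u, hu, fun m z s hs hy hY => le_trans ?_ (hub m z s hs hy hY)⟩
  rw [fourierTerm_eq, norm_mul, norm_div]
  gcongr
  exact norm_sum_le _ _

theorem summable_norm_fourierTerm {k : ℤ} {n : ℕ} (hk : |k| = 2 * n) (z : UpperHalfPlane) (s : ℂ) :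
    Summable fun m : {m : ℤ // m ≠ 0} => ‖fourierTerm k m z s‖ := by
  obtain ⟨u, hu, hub⟩ := exists_summable_bound_fourierTerm hk |s.re| z.im z.im_pos
  exact Summable.of_nonneg_of_le (fun _ => norm_nonneg _)
    (fun m => hub m z s le_rfl le_rfl le_rfl) hu

/-- On a compact set Im z lies between positive bounds and Re s is bounded, so the Weierstrass
M-test applies. -/
theorem summableUniformlyOn_fourierTerm {k : ℤ} {n : ℕ} (hk : |k| = 2 * n)
    {C : Set (UpperHalfPlane × ℂ)} (hC : IsCompact C) :
    SummableUniformlyOn (fun (m : {m : ℤ // m ≠ 0}) (p : UpperHalfPlane × ℂ) =>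
        fourierTerm k m p.1 p.2) C ∧
      SummableUniformlyOn (fun (m : {m : ℤ // m ≠ 0}) (p : UpperHalfPlane × ℂ) =>
        ‖fourierTerm k m p.1 p.2‖) C := by
  have hc : ContinuousOn (fun p : UpperHalfPlane × ℂ => p.1.im) C :=
    (UpperHalfPlane.continuous_im.comp continuous_fst).continuousOn
  obtain ⟨y₀, hy₀, hy⟩ := hC.exists_forall_le' hc (a := 0) fun p _ => p.1.im_pos
  obtain ⟨Y, hY⟩ := hC.exists_bound_of_continuousOn hc
  obtain ⟨A, hA⟩ := hC.exists_bound_of_continuousOn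
    (f := fun p : UpperHalfPlane × ℂ => p.2.re) (by fun_prop)
  obtain ⟨u, hu, hub⟩ := exists_summable_bound_fourierTerm hk A Y hy₀
  have hb : ∀ m, ∀ p ∈ C, ‖fourierTerm k m p.1 p.2‖ ≤ u m := fun m p hp =>
    hub m p.1 p.2 (hA p hp) (hy p hp) ((le_abs_self _).trans (hY p hp))
  exact ⟨(HasSumUniformlyOn.of_norm_le_summable hu hb).summableUniformlyOn,
    (HasSumUniformlyOn.of_norm_le_summable hu fun m p hp => by
      rw [norm_norm]; exact hb m p hp).summableUniformlyOn⟩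

theorem differentiable_fourierTerm (k : ℤ) (m : {m : ℤ // m ≠ 0}) (z : UpperHalfPlane) :
    Differentiable ℂ (fourierTerm k m z) := by
  have hN : ((m.1.natAbs : ℕ) : ℂ) ≠ 0 := by
    exact_mod_cast Int.natAbs_ne_zero.2 m.2
  have h1 : Differentiable ℂ fun s : ℂ => sigma (2 * s - 1) m.1.natAbs := by
    unfold sigma
    refine Differentiable.fun_sum fun d hd => ?_
    have hd0 : (d : ℂ) ≠ 0 := by exact_mod_cast (Nat.pos_of_mem_divisors hd).ne'
    intro s
    exact DifferentiableAt.const_cpow (by fun_prop) (Or.inl hd0)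
  have h2 : Differentiable ℂ fun s : ℂ => (m.1.natAbs : ℂ) ^ s := fun s =>
    differentiableAt_id.const_cpow (Or.inl hN)
  have hpos : 0 < 2 * Real.pi * |((m.1 : ℂ) * (z : ℂ)).im| := by
    have := z.im_pos
    have hm : (m.1 : ℝ) ≠ 0 := by exact_mod_cast m.2
    rw [im_intCast_mul]
    positivity
  have h3 : Differentiable ℂ fun s : ℂ => besselSum k m.1 z s := by
    unfold besselSum
    refine Differentiable.fun_sum fun r _ => ?_
    refine Differentiable.const_mul ?_ _
    unfold whittakerW
    refine Differentiable.mul_const (Differentiable.const_mul ?_ _) _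
    exact (differentiable_besselK hpos).comp (by fun_prop : Differentiable ℂ fun s : ℂ => s + r - 1 / 2)
  exact (h1.div h2 fun s h => hN (cpow_eq_zero_iff _ _ |>.1 h).1).mul h3

theorem differentiable_tsum_fourierTerm {k : ℤ} {n : ℕ} (hk : |k| = 2 * n) (z : UpperHalfPlane) :
    Differentiable ℂ fun s => ∑' m : {m : ℤ // m ≠ 0}, fourierTerm k m z s := by
  intro s
  obtain ⟨u, hu, hub⟩ := exists_summable_bound_fourierTerm hk (|s.re| + 1) z.im z.im_pos
  have h := differentiableOn_tsum_of_summable_norm (F := fun m s => fourierTerm k m z s) hu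
    (fun m => (differentiable_fourierTerm k m z).differentiableOn) (Metric.isOpen_ball (x := s) (ε := 1))
    fun m w hw => hub m z w (by
      have h1 : |w.re - s.re| ≤ ‖w - s‖ := by rw [← sub_re]; exact abs_re_le_norm _
      rw [Metric.mem_ball, dist_eq_norm] at hw
      have h2 := abs_sub_abs_le_abs_sub w.re s.re
      linarith) le_rfl le_rfl
  exact h.differentiableAt (Metric.ball_mem_nhds _ one_pos)

end NonholomorphicEisenstein
end

/-! ### From cosets to lattice vectors -/

noncomputable section

namespace NonholomorphicEisenstein

open Complex Set Filter

/-- The term of the Eisenstein series attached to a bottom row `(c, d)`. -/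
def rowTerm (k : ℤ) (z : UpperHalfPlane) (s : ℂ) (c d : ℤ) : ℂ :=
  (((c : ℂ) * z + d) / (‖(c : ℂ) * z + d‖ : ℂ)) ^ (-k) *
    ((z.im / ‖(c : ℂ) * z + d‖ ^ 2 : ℝ) : ℂ) ^ s

theorem summand_eq_rowTerm (k : ℤ) (z : UpperHalfPlane) (s : ℂ) (γ : SL(2, ℤ)) :
    summand k z s γ = rowTerm k z s (γ 1 0) (γ 1 1) := by
  have h : (γ • z).im = z.im / ‖autFactor γ z‖ ^ 2 := by
    rw [ModularGroup.im_smul_eq_div_normSq, ← Complex.normSq_eq_norm_sq]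
    rfl
  rw [summand, h]
  rfl

/-- Positive scaling keeps the direction of cz + d and changes only its absolute value; this
homogeneity produces ζ(2s). -/
theorem rowTerm_mul (k : ℤ) (z : UpperHalfPlane) (s : ℂ) {e : ℤ} (he : 0 < e) (c d : ℤ) :
    rowTerm k z s (e * c) (e * d) = 1 / (e : ℂ) ^ (2 * s) * rowTerm k z s c d := by
  have heR : (0 : ℝ) < e := by exact_mod_cast he
  have heC : (e : ℂ) ≠ 0 := by exact_mod_cast he.ne'
  unfold rowTerm
  have h1 : (((e * c : ℤ) : ℂ) * z + ((e * d : ℤ) : ℂ)) = e * ((c : ℂ) * z + d) := by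
    push_cast; ring
  have h2 : ‖(e : ℂ)‖ = e := by rw [Complex.norm_intCast, abs_of_pos heR]
  rw [h1, norm_mul, h2]
  have h3 : (e * ((c : ℂ) * z + d)) / ((e * ‖(c : ℂ) * z + d‖ : ℝ) : ℂ) =
      ((c : ℂ) * z + d) / (‖(c : ℂ) * z + d‖ : ℂ) := by
    push_cast
    rw [mul_div_mul_left _ _ heC]
  have h4 : z.im / (e * ‖(c : ℂ) * z + d‖) ^ 2 =
      ((e : ℝ) ^ 2)⁻¹ * (z.im / ‖(c : ℂ) * z + d‖ ^ 2) := by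
    rw [mul_pow, ← div_div, div_right_comm, inv_mul_eq_div]
  have h5 : ((((e : ℝ) ^ 2)⁻¹ : ℝ) : ℂ) ^ s = 1 / (e : ℂ) ^ (2 * s) := by
    rw [ofReal_inv, inv_cpow, one_div]
    · congr 1
      rw [ofReal_pow, pow_two, mul_cpow_ofReal_nonneg heR.le heR.le, ← cpow_add _ _ (by simpa using heC),
        ofReal_intCast, two_mul]
    · rw [arg_ofReal_of_nonneg (by positivity)]
      exact Real.pi_pos.ne
  rw [h4, ofReal_mul (((e : ℝ) ^ 2)⁻¹), mul_cpow_ofReal_nonneg (by positivity)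
    (by have := z.im_pos; positivity), h5, h3]
  ring

/-- Nonzero integer vectors up to sign. -/
abbrev HalfLattice : Type := {p : ℤ × ℤ // 0 < p.1 ∨ (p.1 = 0 ∧ 0 < p.2)}

theorem gcd_pos_of_halfLattice (p : HalfLattice) : 0 < Int.gcd p.1.1 p.1.2 := by
  rw [Int.gcd_pos_iff]
  rcases p.2 with h | h <;> omega

theorem exists_bottom_row {c d : ℤ} (h : IsCoprime c d) : ∃ γ : SL(2, ℤ), γ 1 0 = c ∧ γ 1 1 = d := by
  obtain ⟨γ, -, hγ⟩ := ModularGroup.bottom_row_surj (R := ℤ) (a := ![c, d]) (by simpa using h)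
  exact ⟨γ, congrFun hγ 0, congrFun hγ 1⟩

theorem exists_primitive_bottom_row (p : HalfLattice) :
    ∃ γ : SL(2, ℤ), γ 1 0 * (Int.gcd p.1.1 p.1.2 : ℤ) = p.1.1 ∧
      γ 1 1 * (Int.gcd p.1.1 p.1.2 : ℤ) = p.1.2 := by
  have hg := gcd_pos_of_halfLattice p
  obtain ⟨γ, h1, h2⟩ := exists_bottom_row
    (Int.isCoprime_iff_gcd_eq_one.2 (Int.gcd_ediv_gcd_ediv_gcd hg))
  exact ⟨γ, by rw [h1, Int.ediv_mul_cancel (Int.gcd_dvd_left _ _)],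
    by rw [h2, Int.ediv_mul_cancel (Int.gcd_dvd_right _ _)]⟩

theorem mem_GammaInfty_iff (g : SL(2, ℤ)) : g ∈ GammaInfty ↔ g 1 0 = 0 := by
  constructor
  · rintro ⟨n, h | h⟩ <;> rw [h] <;> simp
  · intro h
    have hdet := g.det_coe
    rw [Matrix.det_fin_two, h, mul_zero, sub_zero] at hdet
    rcases Int.mul_eq_one_iff_eq_one_or_neg_one.1 hdet with ⟨h0, h1⟩ | ⟨h0, h1⟩
    · exact ⟨g 0 1, Or.inl (by ext i j; fin_cases i <;> fin_cases j <;> simp [h, h0, h1])⟩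
    · exact ⟨-g 0 1, Or.inr (by ext i j; fin_cases i <;> fin_cases j <;> simp [h, h0, h1])⟩

/-- The condition is the vanishing of the lower left entry of b a⁻¹: cosets correspond to bottom
rows up to proportionality. -/
theorem cosets_mk_eq_iff (a b : SL(2, ℤ)) :
    (Quotient.mk (QuotientGroup.rightRel GammaInfty) a : Cosets) = Quotient.mk _ b ↔
      b 1 0 * a 1 1 = b 1 1 * a 1 0 := by
  rw [Quotient.eq, QuotientGroup.rightRel_apply, mem_GammaInfty_iff,
    Matrix.SpecialLinearGroup.coe_mul, Matrix.SpecialLinearGroup.coe_inv, Matrix.adjugate_fin_two]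
  simp [Matrix.mul_apply, Fin.sum_univ_two]
  constructor <;> intro h <;> linarith

/-- The content of a vector together with the coset of its primitive part. -/
def contentCoset (p : HalfLattice) : ℕ+ × Cosets :=
  (⟨Int.gcd p.1.1 p.1.2, gcd_pos_of_halfLattice p⟩,
    Quotient.mk _ (exists_primitive_bottom_row p).choose)

/-- Coprimality makes corresponding entries divide each other, so they agree up to separate signs.
If the signs differ, a product of two entries is zero, and a zero entry makes its sign irrelevant.
-/
theorem eq_or_eq_neg_of_proportional {c d c' d' : ℤ} (h1 : IsCoprime c d) (h2 : IsCoprime c' d')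
    (h : c * d' = d * c') : (c = c' ∧ d = d') ∨ (c = -c' ∧ d = -d') := by
  have e1 : c ∣ c' := h1.dvd_of_dvd_mul_left (Dvd.intro _ h)
  have e2 : c' ∣ c := h2.dvd_of_dvd_mul_right (Dvd.intro_left _ h.symm)
  have e3 : d ∣ d' := h1.symm.dvd_of_dvd_mul_left (Dvd.intro _ h.symm)
  have e4 : d' ∣ d := h2.symm.dvd_of_dvd_mul_right (Dvd.intro_left _ h)
  rcases Int.natAbs_eq_natAbs_iff.1 (Int.natAbs_eq_of_dvd_dvd e1 e2) with rfl | rfl <;>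
    rcases Int.natAbs_eq_natAbs_iff.1 (Int.natAbs_eq_of_dvd_dvd e3 e4) with rfl | rfl
  · simp
  · have h0 : c * d' = 0 := by linarith
    rcases mul_eq_zero.1 h0 with h' | h' <;> simp [h']
  · have h0 : c' * d = 0 := by linarith
    rcases mul_eq_zero.1 h0 with h' | h' <;> simp [h']
  · simp

/-- A nonzero vector is its content times a primitive vector; primitive vectors up to sign are the
cosets, and the half lattice holds exactly one of each pair ±p. -/
theorem contentCoset_bijective : Function.Bijective contentCoset := by
  constructor
  · intro p q h
    obtain ⟨hp1, hp2⟩ := (exists_primitive_bottom_row p).choose_spec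
    obtain ⟨hq1, hq2⟩ := (exists_primitive_bottom_row q).choose_spec
    have hg : Int.gcd p.1.1 p.1.2 = Int.gcd q.1.1 q.1.2 :=
      congrArg (fun x : ℕ+ × Cosets => (x.1 : ℕ)) h
    have hc := (cosets_mk_eq_iff _ _).1 (congrArg Prod.snd h)
    set a := (exists_primitive_bottom_row p).choose
    set b := (exists_primitive_bottom_row q).choose
    rw [← hg] at hq1 hq2
    have hpos : (0 : ℤ) < (Int.gcd p.1.1 p.1.2 : ℤ) := by exact_mod_cast gcd_pos_of_halfLattice p
    set g : ℤ := (Int.gcd p.1.1 p.1.2 : ℤ)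
    have hs : p.1.1 = q.1.1 ∧ p.1.2 = q.1.2 := by
      rcases eq_or_eq_neg_of_proportional (ModularGroup.bottom_row_coprime b)
        (ModularGroup.bottom_row_coprime a) hc with ⟨h1, h2⟩ | ⟨h1, h2⟩
      · rw [← hp1, ← hp2, ← hq1, ← hq2, h1, h2]; simp
      · rw [h1] at hq1
        rw [h2] at hq2
        have e1 : q.1.1 = -p.1.1 := by rw [← hq1, ← hp1]; ring
        have e2 : q.1.2 = -p.1.2 := by rw [← hq2, ← hp2]; ring
        have := p.2
        have := q.2
        omega
    exact Subtype.ext (Prod.ext hs.1 hs.2)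
  · rintro ⟨e, q⟩
    obtain ⟨γ, rfl⟩ := Quotient.exists_rep q
    have hcop := ModularGroup.bottom_row_coprime γ
    have he : (0 : ℤ) < (e : ℕ) := by exact_mod_cast e.pos
    -- The sign ε puts the bottom row of the representative into the half lattice.
    obtain ⟨ε, hε, hpos⟩ : ∃ ε : ℤ, (ε = 1 ∨ ε = -1) ∧
        (0 < ε * γ 1 0 ∨ (ε * γ 1 0 = 0 ∧ 0 < ε * γ 1 1)) := by
      have hne : ¬ (γ 1 0 = 0 ∧ γ 1 1 = 0) := by
        rintro ⟨h1, h2⟩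
        rw [h1, h2] at hcop
        simp [isCoprime_zero_left] at hcop
      by_cases h : 0 < γ 1 0 ∨ (γ 1 0 = 0 ∧ 0 < γ 1 1)
      · exact ⟨1, Or.inl rfl, by simpa using h⟩
      · exact ⟨-1, Or.inr rfl, by omega⟩
    have hpos' : 0 < (e : ℕ) * (ε * γ 1 0) ∨
        ((e : ℕ) * (ε * γ 1 0) = 0 ∧ 0 < (e : ℕ) * (ε * γ 1 1)) := by
      rcases hpos with h | ⟨h1, h2⟩
      · exact Or.inl (mul_pos he h)
      · exact Or.inr ⟨by rw [h1, mul_zero], mul_pos he h2⟩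
    let p : HalfLattice := ⟨((e : ℕ) * (ε * γ 1 0), (e : ℕ) * (ε * γ 1 1)), hpos'⟩
    have hgcd : Int.gcd p.1.1 p.1.2 = e := by
      simp only [p]
      rw [Int.gcd_mul_left, Int.gcd_mul_left, Int.isCoprime_iff_gcd_eq_one.1 hcop]
      rcases hε with rfl | rfl <;> simp
    obtain ⟨hp1, hp2⟩ := (exists_primitive_bottom_row p).choose_spec
    refine ⟨p, Prod.ext (PNat.eq hgcd) ((cosets_mk_eq_iff _ _).2 ?_)⟩
    set a := (exists_primitive_bottom_row p).choose
    rw [hgcd, mul_comm] at hp1 hp2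
    have h1 : a 1 0 = ε * γ 1 0 := mul_left_cancel₀ he.ne' hp1
    have h2 : a 1 1 = ε * γ 1 1 := mul_left_cancel₀ he.ne' hp2
    rw [h1, h2]
    ring

theorem contentCoset_term {k : ℤ} (hk : Even k) (z : UpperHalfPlane) (s : ℂ) (p : HalfLattice) :
    1 / (((contentCoset p).1 : ℕ) : ℂ) ^ (2 * s) * cosetTerm k hk z s (contentCoset p).2 =
      rowTerm k z s p.1.1 p.1.2 := by
  obtain ⟨hp1, hp2⟩ := (exists_primitive_bottom_row p).choose_spec
  have h : cosetTerm k hk z s (contentCoset p).2 =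
      summand k z s (exists_primitive_bottom_row p).choose := rfl
  rw [h, summand_eq_rowTerm]
  have hg : (0 : ℤ) < (Int.gcd p.1.1 p.1.2 : ℤ) := by exact_mod_cast gcd_pos_of_halfLattice p
  have h2 := rowTerm_mul k z s hg ((exists_primitive_bottom_row p).choose 1 0)
    ((exists_primitive_bottom_row p).choose 1 1)
  rw [mul_comm _ ((exists_primitive_bottom_row p).choose 1 0),
    mul_comm _ ((exists_primitive_bottom_row p).choose 1 1), hp1, hp2] at h2
  rw [h2]
  simp [contentCoset]

theorem norm_zpow_div_norm_le (j : ℂ) (hj : j ≠ 0) (k : ℤ) : ‖(j / (‖j‖ : ℂ)) ^ k‖ = 1 := by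
  rw [norm_zpow, norm_div, Complex.norm_real, norm_norm, div_self (norm_ne_zero_iff.2 hj), one_zpow]

/-- The weight factor has absolute value 1, so the comparison is with the lattice sum of exponent 2
Re s > 2. -/
theorem summable_norm_rowTerm (k : ℤ) (z : UpperHalfPlane) {s : ℂ} (hs : 1 < s.re) :
    Summable fun p : HalfLattice => ‖rowTerm k z s p.1.1 p.1.2‖ := by
  have h1 := (EisensteinSeries.summable_one_div_norm_rpow (k := 2 * s.re) (by linarith)).mul_left
    (z.im ^ s.re * EisensteinSeries.r z ^ (-(2 * s.re)))
  have hinj : Function.Injective fun p : HalfLattice => (![p.1.1, p.1.2] : Fin 2 → ℤ) := by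
    intro p q h
    exact Subtype.ext (Prod.ext (congrFun h 0) (congrFun h 1))
  refine Summable.of_nonneg_of_le (fun _ => norm_nonneg _) (fun p => ?_) (h1.comp_injective hinj)
  have hb := EisensteinSeries.summand_bound z (k := 2 * s.re) (by linarith) ![p.1.1, p.1.2]
  simp only [Matrix.cons_val_zero, Matrix.cons_val_one] at hb
  have hj : (p.1.1 : ℂ) * z + p.1.2 ≠ 0 := by
    intro h
    have h1 := congrArg im h
    have h2 := congrArg re h
    have hz := z.im_pos.ne'
    simp [hz] at h1
    simp [h1] at h2
    have := p.2
    omega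
  have hjn : 0 < ‖(p.1.1 : ℂ) * z + p.1.2‖ := norm_pos_iff.2 hj
  have hz := z.im_pos
  rw [rowTerm, norm_mul, norm_zpow_div_norm_le _ hj, one_mul,
    norm_cpow_eq_rpow_re_of_pos (by positivity), Real.div_rpow hz.le (by positivity), div_eq_mul_inv,
    ← Real.rpow_natCast, ← Real.rpow_mul hjn.le, ← Real.rpow_neg hjn.le, Nat.cast_ofNat]
  simp only [Function.comp]
  calc _ ≤ _ := mul_le_mul_of_nonneg_left hb (Real.rpow_nonneg hz.le _)
    _ = _ := by ring

/-- Splitting a half lattice into the rows with positive and with vanishing first entry. -/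
def halfLatticeEquiv : (ℕ+ × ℤ) ⊕ ℕ+ ≃ HalfLattice where
  toFun := Sum.elim (fun x => ⟨((x.1 : ℕ), x.2), Or.inl (Int.natCast_pos.2 x.1.pos)⟩)
    (fun d => ⟨(0, (d : ℕ)), Or.inr ⟨rfl, Int.natCast_pos.2 d.pos⟩⟩)
  invFun p := if h : 0 < p.1.1 then Sum.inl (⟨p.1.1.toNat, by omega⟩, p.1.2)
    else Sum.inr ⟨p.1.2.toNat, by have := p.2; omega⟩
  left_inv := by
    rintro (⟨c, d⟩ | d)
    · have : (0 : ℤ) < (c : ℕ) := by exact_mod_cast c.pos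
      simp only [Sum.elim_inl, Int.toNat_natCast]
      exact dif_pos this
    · simp only [Sum.elim_inr, lt_irrefl, Int.toNat_natCast]
      rfl
  right_inv := by
    rintro ⟨⟨c, d⟩, h⟩
    by_cases hc : 0 < c
    · simp [hc, hc.le]
    · obtain ⟨rfl, hd⟩ : c = 0 ∧ 0 < d := by simpa [hc] using h
      simp only [lt_irrefl, dif_neg, not_false_eq_true]
      exact Subtype.ext (Prod.ext rfl (Int.toNat_of_nonneg hd.le))

theorem zeta_eq_tsum_pnat {w : ℂ} (hw : 1 < w.re) :
    Summable (fun e : ℕ+ => ‖1 / ((e : ℕ) : ℂ) ^ w‖) ∧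
      riemannZeta w = ∑' e : ℕ+, 1 / ((e : ℕ) : ℂ) ^ w := by
  constructor
  · exact ((Complex.summable_one_div_nat_cpow.2 hw).norm).comp_injective PNat.coe_injective
  · rw [zeta_eq_tsum_one_div_nat_add_one_cpow hw,
      tsum_pnat_eq_tsum_succ (f := fun e : ℕ => 1 / (e : ℂ) ^ w)]
    simp

theorem summable_cosetTerm {k : ℤ} (hk : Even k) (z : UpperHalfPlane) {s : ℂ} (hs : 1 < s.re) :
    Summable fun q => ‖cosetTerm k hk z s q‖ := by
  let e := Equiv.ofBijective contentCoset contentCoset_bijective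
  have h : Summable fun x : ℕ+ × Cosets => ‖1 / ((x.1 : ℕ) : ℂ) ^ (2 * s) * cosetTerm k hk z s x.2‖ := by
    rw [← e.summable_iff]
    refine (summable_norm_rowTerm k z hs).congr fun p => ?_
    rw [← contentCoset_term hk z s p]
    rfl
  -- The vectors of content 1 are a subfamily, and they are the cosets themselves.
  have h2 := h.comp_injective (Prod.mk_right_injective (1 : ℕ+))
  refine h2.congr fun q => ?_
  simp

/-- The product of the two absolutely convergent series is indexed by content and coset, hence by
the half lattice, which is then split according to c = 0 or c > 0. -/
theorem zeta_mul_eisenstein {k : ℤ} (hk : Even k) (z : UpperHalfPlane) {s : ℂ} (hs : 1 < s.re) :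
    riemannZeta (2 * s) * eisenstein k hk z s =
      riemannZeta (2 * s) * (z.im : ℂ) ^ s + ∑' c : ℕ+, ∑' d : ℤ, rowTerm k z s (c : ℕ) d := by
  let e := Equiv.ofBijective contentCoset contentCoset_bijective
  have h2s : 1 < (2 * s).re := by simp; linarith
  obtain ⟨hz1, hz2⟩ := zeta_eq_tsum_pnat h2s
  have h1 : riemannZeta (2 * s) * eisenstein k hk z s =
      ∑' p : HalfLattice, rowTerm k z s p.1.1 p.1.2 := by
    rw [hz2, eisenstein, tsum_mul_tsum_of_summable_norm hz1 (summable_cosetTerm hk z hs),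
      ← e.tsum_eq]
    exact tsum_congr fun p => contentCoset_term hk z s p
  have hsum := (summable_norm_rowTerm k z hs).of_norm
  rw [← halfLatticeEquiv.summable_iff] at hsum
  have hl := hsum.comp_injective Sum.inl_injective
  have hr := hsum.comp_injective Sum.inr_injective
  rw [h1, ← halfLatticeEquiv.tsum_eq]
  refine ((hl.hasSum.sum hr.hasSum).tsum_eq).trans ?_
  rw [add_comm]
  congr 1
  · rw [hz2, ← tsum_mul_right]
    refine tsum_congr fun d => ?_
    -- The vectors with c = 0 are the multiples d·(0, 1), which sum to ζ(2s) y^s.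
    have h3 := rowTerm_mul k z s (e := (d : ℕ)) (by exact_mod_cast d.pos) 0 1
    simp only [mul_zero, mul_one] at h3
    have h4 : rowTerm k z s 0 1 = (z.im : ℂ) ^ s := by simp [rowTerm]
    rw [h4] at h3
    simpa [halfLatticeEquiv] using h3
  · exact hl.tsum_prod

end NonholomorphicEisenstein
end

/-! ### Regrouping by divisors and the Fourier coefficients of a row -/

noncomputable section

namespace NonholomorphicEisenstein

open Complex Set Filter FourierTransform Asymptotics

/-- The contribution of the frequency `m` in the rows with first entry `c`. -/
def rowFourierTerm (k : ℤ) (z : UpperHalfPlane) (s : ℂ) (x : ℕ+ × {m : ℤ // m ≠ 0}) : ℂ :=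
  ((x.2.1.natAbs : ℕ) : ℂ) ^ (2 * s - 1) / (((x.2.1 * (x.1 : ℕ)).natAbs : ℕ) : ℂ) ^ s *
    besselSum k (x.2.1 * (x.1 : ℕ)) z s

/-- The term of `fourierTerm` attached to a divisor. -/
def divisorTerm (k : ℤ) (z : UpperHalfPlane) (s : ℂ)
    (x : Σ N : {m : ℤ // m ≠ 0}, {d : ℕ // d ∈ N.1.natAbs.divisors}) : ℂ :=
  ((x.2.1 : ℕ) : ℂ) ^ (2 * s - 1) / ((x.1.1.natAbs : ℕ) : ℂ) ^ s * besselSum k x.1.1 z s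

/-- The product of a pair as an integer with a marked divisor. -/
def productDivisor (x : ℕ+ × {m : ℤ // m ≠ 0}) :
    Σ N : {m : ℤ // m ≠ 0}, {d : ℕ // d ∈ N.1.natAbs.divisors} :=
  ⟨⟨x.2.1 * (x.1 : ℕ), mul_ne_zero x.2.2 (by exact_mod_cast x.1.ne_zero)⟩, ⟨x.2.1.natAbs, by
    rw [Nat.mem_divisors, Int.natAbs_mul]
    refine ⟨Dvd.intro _ rfl, mul_ne_zero (Int.natAbs_ne_zero.2 x.2.2) ?_⟩
    rw [Int.natAbs_natCast]
    exact x.1.ne_zero⟩⟩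

/-- From N = mc and d = |m| the pair is recovered: c > 0 forces m to have the sign of N, and c =
|N|/d. -/
theorem productDivisor_bijective : Function.Bijective productDivisor := by
  constructor
  · rintro ⟨c, m, hm⟩ ⟨c', m', hm'⟩ h
    have h1 : m * (c : ℕ) = m' * (c' : ℕ) := congrArg (fun x => x.1.1) h
    have h2 : m.natAbs = m'.natAbs := congrArg (fun x => (x.2 : ℕ)) h
    have hc : (c : ℕ) = c' := by
      have := congrArg Int.natAbs h1
      rw [Int.natAbs_mul, Int.natAbs_mul, h2, Int.natAbs_natCast, Int.natAbs_natCast] at this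
      exact Nat.eq_of_mul_eq_mul_left (Int.natAbs_pos.2 hm') this
    rw [hc] at h1
    have hm2 : m = m' := mul_right_cancel₀ (by exact_mod_cast c'.ne_zero) h1
    exact Prod.ext (PNat.eq hc) (Subtype.ext hm2)
  · rintro ⟨⟨N, hN⟩, d, hd⟩
    obtain ⟨c, hc⟩ := Nat.dvd_of_mem_divisors hd
    have hd0 := Nat.pos_of_mem_divisors hd
    simp only at hc
    have hc0 : 0 < c := by
      rcases Nat.eq_zero_or_pos c with h | h
      · rw [h, mul_zero] at hc
        exact absurd hc (Int.natAbs_ne_zero.2 hN)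
      · exact h
    have hs : N.sign * (d : ℤ) ≠ 0 :=
      mul_ne_zero (by rwa [Ne, Int.sign_eq_zero_iff_zero]) (by exact_mod_cast hd0.ne')
    refine ⟨(⟨c, hc0⟩, ⟨N.sign * d, hs⟩), Sigma.subtype_ext (Subtype.ext ?_) ?_⟩
    · change N.sign * d * (c : ℤ) = N
      rw [mul_assoc, ← Nat.cast_mul, ← hc, Int.sign_mul_natAbs]
    · change (N.sign * (d : ℤ)).natAbs = d
      rw [Int.natAbs_mul, Int.natAbs_sign_of_ne_zero hN, one_mul, Int.natAbs_natCast]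

theorem summable_divisorTerm {k : ℤ} {n : ℕ} (hk : |k| = 2 * n) (z : UpperHalfPlane) (s : ℂ) :
    Summable (divisorTerm k z s) := by
  obtain ⟨u, hu, hub⟩ := exists_summable_bound hk |s.re| z.im z.im_pos
  refine Summable.of_norm ?_
  rw [summable_sigma_of_nonneg fun _ => norm_nonneg _]
  refine ⟨fun N => Summable.of_finite, ?_⟩
  refine Summable.of_nonneg_of_le (fun N => tsum_nonneg fun _ => norm_nonneg _) (fun N => ?_) hu
  refine le_trans (le_of_eq ?_) (hub N z s le_rfl le_rfl le_rfl)
  refine (Finset.tsum_subtype N.1.natAbs.divisors (fun d => ‖(d : ℂ) ^ (2 * s - 1) /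
    ((N.1.natAbs : ℕ) : ℂ) ^ s * besselSum k N.1 z s‖)).trans ?_
  rw [Finset.sum_div, Finset.sum_mul]
  exact Finset.sum_congr rfl fun d _ => by rw [norm_mul, norm_div]

theorem divisorTerm_productDivisor (k : ℤ) (z : UpperHalfPlane) (s : ℂ)
    (x : ℕ+ × {m : ℤ // m ≠ 0}) :
    divisorTerm k z s (productDivisor x) = rowFourierTerm k z s x := by
  simp only [divisorTerm, rowFourierTerm, productDivisor]

theorem summable_rowFourierTerm {k : ℤ} {n : ℕ} (hk : |k| = 2 * n) (z : UpperHalfPlane) (s : ℂ) :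
    Summable (rowFourierTerm k z s) := by
  have h := (summable_divisorTerm hk z s).comp_injective productDivisor_bijective.injective
  exact h.congr fun x => (divisorTerm_productDivisor k z s x).symm

/-- Absolute convergence permits regrouping by N = mc; the sum of |m|^(2s-1) over the divisors |m|
of N is the divisor sum σ_(2s-1)(|N|). -/
theorem tsum_rowFourierTerm {k : ℤ} {n : ℕ} (hk : |k| = 2 * n) (z : UpperHalfPlane) (s : ℂ) :
    ∑' c : ℕ+, ∑' m : {m : ℤ // m ≠ 0}, rowFourierTerm k z s (c, m) =
      ∑' N : {m : ℤ // m ≠ 0}, fourierTerm k N z s := by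
  have h1 := (Equiv.ofBijective _ productDivisor_bijective).tsum_eq (divisorTerm k z s)
  simp only [Equiv.ofBijective_apply, divisorTerm_productDivisor] at h1
  rw [← (summable_rowFourierTerm hk z s).tsum_prod, h1]
  rw [(summable_divisorTerm hk z s).tsum_sigma]
  refine tsum_congr fun N => ?_
  refine (Finset.tsum_subtype N.1.natAbs.divisors (fun d => (d : ℂ) ^ (2 * s - 1) /
    ((N.1.natAbs : ℕ) : ℂ) ^ s * besselSum k N.1 z s)).trans ?_
  rw [fourierTerm_eq, sigma, Finset.sum_div, Finset.sum_mul]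

/-- The sign of the weight. -/
def weightSign (k : ℤ) : ℝ := if 0 ≤ k then 1 else -1

theorem weightSign_eq_or (k : ℤ) : weightSign k = 1 ∨ weightSign k = -1 := by
  unfold weightSign; split_ifs <;> simp

/-- Negative weight amounts to replacing v by -v; the resulting signs are those in the definition of
P^n_r for negative n. -/
theorem weightSign_zpow_mul_laguerre {k : ℤ} {n : ℕ} (hk : |k| = 2 * n) (r : ℤ) (x : ℝ) :
    (weightSign k) ^ r * laguerrePNonneg n r (weightSign k * x) = laguerreP (k / 2) r x := by
  unfold laguerreP weightSign
  by_cases h : 0 ≤ k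
  · have h1 : k / 2 = n := by rw [abs_of_nonneg h] at hk; omega
    rw [if_pos h, if_pos (by omega), h1]
    simp
  · have h1 : -(k / 2) = n := by rw [abs_of_neg (by omega)] at hk; omega
    have h2 : ¬ 0 ≤ k / 2 := by omega
    rw [if_neg h, if_neg h2, h1]
    simp

/-- Let j = X + iv. For k ≥ 0 the inverse of j/|j| is its conjugate, which gives (X - iv)^(2n); for
k < 0 the power of j itself appears, that is, v with the opposite sign. The factor |j|^(-2n) shifts
the exponent from s to s + n. -/
theorem rowTerm_eq_latticeKernel {k : ℤ} {n : ℕ} (hk : |k| = 2 * n) (z : UpperHalfPlane) (s : ℂ)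
    {c : ℕ} (hc : 0 < c) (d : ℤ) :
    rowTerm k z s c d =
      (z.im : ℂ) ^ s * latticeKernel n (weightSign k * (c * z.im)) s (c * z.re + d) := by
  have hy := z.im_pos
  have hcR : (0 : ℝ) < c := by exact_mod_cast hc
  set X : ℝ := c * z.re + d with hX
  set v : ℝ := c * z.im with hv
  have hvpos : 0 < v := by positivity
  have hj : ((c : ℤ) : ℂ) * z + d = (X : ℂ) + I * v := by
    apply Complex.ext <;> simp [hX, hv]
  have hsq : ‖(X : ℂ) + I * v‖ ^ 2 = X ^ 2 + v ^ 2 := by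
    have := norm_sub_I_mul_sq X (-v)
    simpa using this
  have hpos : 0 < X ^ 2 + v ^ 2 := by positivity
  have hne : ((X ^ 2 + v ^ 2 : ℝ) : ℂ) ≠ 0 := by exact_mod_cast hpos.ne'
  have hjne : (X : ℂ) + I * v ≠ 0 := by
    intro h; rw [h] at hsq; simp at hsq; linarith
  have hnorm : (‖(X : ℂ) + I * v‖ : ℂ) ^ 2 = ((X ^ 2 + v ^ 2 : ℝ) : ℂ) := by
    rw [← hsq]; push_cast; rfl
  have hN0 : (‖(X : ℂ) + I * v‖ : ℂ) ≠ 0 := by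
    exact_mod_cast (norm_ne_zero_iff.2 hjne)
  have hprod : ((X : ℂ) + I * v) * ((X : ℂ) - I * v) = ((X ^ 2 + v ^ 2 : ℝ) : ℂ) := by
    push_cast
    linear_combination -(v : ℂ) ^ 2 * I_sq
  have h1 : (((X : ℂ) + I * v) / (‖(X : ℂ) + I * v‖ : ℂ)) ^ (-k) =
      ((X : ℂ) - I * (weightSign k * v : ℝ)) ^ (2 * n) * (((X ^ 2 + v ^ 2 : ℝ) : ℂ) ^ n)⁻¹ := by
    unfold weightSign
    by_cases h : 0 ≤ k
    · rw [abs_of_nonneg h] at hk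
      rw [if_pos h, one_mul, hk, zpow_neg, ← inv_zpow, inv_div]
      have h2 : (‖(X : ℂ) + I * v‖ : ℂ) / ((X : ℂ) + I * v) =
          ((X : ℂ) - I * v) / (‖(X : ℂ) + I * v‖ : ℂ) := by
        rw [div_eq_div_iff hjne hN0, ← pow_two, hnorm, ← hprod]; ring
      rw [h2, div_zpow, show (2 * (n : ℤ)) = ((2 * n : ℕ) : ℤ) by push_cast; rfl, zpow_natCast,
        zpow_natCast, pow_mul (‖(X : ℂ) + I * v‖ : ℂ), hnorm, div_eq_mul_inv]
    · rw [abs_of_neg (by omega)] at hk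
      rw [if_neg h, hk, show (2 * (n : ℤ)) = ((2 * n : ℕ) : ℤ) by push_cast; rfl, zpow_natCast, div_pow,
        pow_mul (‖(X : ℂ) + I * v‖ : ℂ), hnorm, div_eq_mul_inv]
      congr 2
      push_cast; ring
  have h2 : ((z.im / ‖(X : ℂ) + I * v‖ ^ 2 : ℝ) : ℂ) ^ s =
      (z.im : ℂ) ^ s * ((X ^ 2 + v ^ 2 : ℝ) : ℂ) ^ (-s) := by
    rw [hsq, div_eq_mul_inv, ofReal_mul, mul_cpow_ofReal_nonneg hy.le (by positivity), ofReal_inv,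
      inv_cpow, cpow_neg]
    rw [arg_ofReal_of_nonneg hpos.le]
    exact Real.pi_pos.ne
  have h3 : (weightSign k * v) ^ 2 = v ^ 2 := by
    rcases weightSign_eq_or k with h | h <;> rw [h] <;> ring
  rw [rowTerm, hj, h1, h2, latticeKernel, h3, neg_add, cpow_add _ _ hne, cpow_neg _ (n : ℂ),
    cpow_natCast]
  ring

theorem isBigO_latticeKernel (n : ℕ) {v : ℝ} (hv : v ≠ 0) {s : ℂ} (hs : 0 < s.re) :
    latticeKernel n v s =O[cocompact ℝ] fun x : ℝ => |x| ^ (-(2 * s.re)) := by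
  refine IsBigO.of_bound 1 ?_
  have h : ∀ᶠ x : ℝ in cocompact ℝ, x ≠ 0 :=
    (isCompact_singleton (x := (0 : ℝ))).compl_mem_cocompact
  filter_upwards [h] with x hx
  have hx2 : 0 < x ^ 2 := by positivity
  rw [norm_latticeKernel n hv, one_mul, Real.norm_eq_abs, abs_of_nonneg (by positivity),
    show -(2 * s.re) = ((2 : ℕ) : ℝ) * (-s.re) by push_cast; ring, Real.rpow_mul (abs_nonneg x),
    Real.rpow_natCast, sq_abs]
  exact Real.rpow_le_rpow_of_nonpos hx2 (by nlinarith [sq_nonneg v]) (by linarith)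

theorem abs_intCast_eq_natAbs (m : ℤ) : |(m : ℝ)| = (m.natAbs : ℝ) := by
  rw [Nat.cast_natAbs, Int.cast_abs]

/-- The nonzero Fourier coefficients of a row sum. -/
theorem fourier_coefficient {k : ℤ} {n : ℕ} (hk : |k| = 2 * n) (z : UpperHalfPlane) {s : ℂ}
    (hs : 1 < s.re) (x : ℕ+ × {m : ℤ // m ≠ 0}) :
    (Real.pi : ℂ) ^ (-s) * Gamma (s + n) * ((z.im : ℂ) ^ s *
      (𝓕 (latticeKernel n (weightSign k * ((x.1 : ℕ) * z.im)) s) (x.2.1 : ℝ) *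
        cexp (2 * Real.pi * I * x.2.1 * ((x.1 : ℕ) * z.re : ℝ)))) =
      (2 : ℂ) ^ (-|k|) * rowFourierTerm k z s x := by
  obtain ⟨c, m, hm⟩ := x
  have hy := z.im_pos
  have hyC : (z.im : ℂ) ≠ 0 := by exact_mod_cast hy.ne'
  have hc : (0 : ℝ) < (c : ℕ) := by exact_mod_cast c.pos
  have hcC : (((c : ℕ) : ℝ) : ℂ) ≠ 0 := by exact_mod_cast hc.ne'
  have hpi : (Real.pi : ℂ) ≠ 0 := by exact_mod_cast Real.pi_pos.ne'
  have hmR : (m : ℝ) ≠ 0 := by exact_mod_cast hm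
  set M : ℝ := |(m : ℝ)| with hM
  have hM0 : 0 < M := abs_pos.2 hmR
  have hMC : (M : ℂ) ≠ 0 := by exact_mod_cast hM0.ne'
  have hMn : ((m.natAbs : ℕ) : ℂ) = (M : ℂ) := by rw [hM, abs_intCast_eq_natAbs]; rfl
  have hMCn : (((m * (c : ℕ)).natAbs : ℕ) : ℂ) = ((M * (c : ℕ) : ℝ) : ℂ) := by
    rw [Int.natAbs_mul, Int.natAbs_natCast]; push_cast; rw [hMn]
  set v : ℝ := weightSign k * ((c : ℕ) * z.im) with hv
  have habsv : |v| = (c : ℕ) * z.im := by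
    rcases weightSign_eq_or k with h | h <;> rw [hv, h, abs_mul] <;>
      simp [abs_of_pos hy]
  have hv0 : v ≠ 0 := by
    rw [← abs_pos, habsv]; positivity
  have hF := fourier_latticeKernel_of_ne_zero n hv0 (s := s) (by linarith) hmR
  have hpi2 : (Real.pi : ℂ) ^ (-s) = (Real.pi : ℂ) ^ (-(s + n)) * (Real.pi : ℂ) ^ n := by
    rw [← cpow_natCast, ← cpow_add _ _ hpi]; congr 1; ring
  have h2k : (2 : ℂ) ^ (-|k|) = (4 : ℂ) ^ (-(n : ℤ)) := by
    rw [hk, show -(2 * (n : ℤ)) = 2 * -(n : ℤ) by ring, zpow_mul]; norm_num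
  have hpi3 : (Real.pi : ℂ) ^ n * (4 * Real.pi : ℂ) ^ (-(n : ℤ)) = (4 : ℂ) ^ (-(n : ℤ)) := by
    rw [mul_zpow, zpow_neg (Real.pi : ℂ), zpow_natCast]
    field_simp
  have hstep : (Real.pi : ℂ) ^ (-s) * Gamma (s + n) * 𝓕 (latticeKernel n v s) (m : ℝ) =
      (4 : ℂ) ^ (-(n : ℤ)) * ∑ r ∈ Finset.Icc (-(n : ℤ)) n,
        (laguerrePNonneg n r (4 * Real.pi * m * v) : ℂ) * ((v / m : ℝ) : ℂ) ^ r *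
          (((M / |v| : ℝ) : ℂ) ^ (s - 1 / 2 + r) *
            (2 * besselK (s - 1 / 2 + r) (2 * Real.pi * (|v| * M)))) := by
    rw [← hpi3, hpi2]
    linear_combination (Real.pi : ℂ) ^ n * hF
  have hn2 : |k| / 2 = n := by omega
  unfold rowFourierTerm besselSum
  simp only
  rw [h2k, hn2]
  have hmain : ∀ r ∈ Finset.Icc (-(n : ℤ)) n,
      (z.im : ℂ) ^ s * cexp (2 * Real.pi * I * m * ((c : ℕ) * z.re : ℝ)) *
      ((laguerrePNonneg n r (4 * Real.pi * m * v) : ℂ) * ((v / m : ℝ) : ℂ) ^ r *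
          (((M / |v| : ℝ) : ℂ) ^ (s - 1 / 2 + r) *
            (2 * besselK (s - 1 / 2 + r) (2 * Real.pi * (|v| * M))))) =
      ((m.natAbs : ℕ) : ℂ) ^ (2 * s - 1) / (((m * (c : ℕ)).natAbs : ℕ) : ℂ) ^ s *
        ((((m * (c : ℕ) : ℤ) : ℂ) / (((m * (c : ℕ)).natAbs : ℕ) : ℂ)) ^ r *
          (laguerreP (k / 2) r (4 * Real.pi * ((m * (c : ℕ) : ℤ) : ℝ) * z.im) : ℂ) *
          whittakerW (s + r) (((m * (c : ℕ) : ℤ) : ℂ) * (z : ℂ))) := by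
    intro r _
    have hL := weightSign_zpow_mul_laguerre hk r (4 * Real.pi * ((m * (c : ℕ) : ℤ) : ℝ) * z.im)
    have e0 : weightSign k * (4 * Real.pi * ((m * (c : ℕ) : ℤ) : ℝ) * z.im) = 4 * Real.pi * m * v := by
      rw [hv]; push_cast; ring
    rw [e0] at hL
    have him : |(((m * (c : ℕ) : ℤ) : ℂ) * (z : ℂ)).im| = |v| * M := by
      rw [im_intCast_mul, abs_mul, abs_of_pos hy, habsv, hM]
      push_cast
      rw [abs_mul, abs_of_pos hc]; ring
    have hre : (((m * (c : ℕ) : ℤ) : ℂ) * (z : ℂ)).re = m * ((c : ℕ) * z.re) := by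
      simp; ring
    unfold whittakerW
    rw [him, hre, hMn, hMCn, ← hL]
    have e1 : (2 * Real.pi * I * m * ((c : ℕ) * z.re : ℝ) : ℂ) =
        2 * Real.pi * I * ((m * ((c : ℕ) * z.re) : ℝ) : ℂ) := by push_cast; ring
    -- The r-th powers combine because (v/m)(|m|/|v|) is the sign of the weight times the sign of m.
    have e2 : ((v / m : ℝ) : ℂ) ^ r * ((M / |v| : ℝ) : ℂ) ^ (s - 1 / 2 + r) =
        ((((m * (c : ℕ) : ℤ) : ℂ) / ((M * (c : ℕ) : ℝ) : ℂ)) ^ r * ((weightSign k : ℝ) : ℂ) ^ r) *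
          ((M / |v| : ℝ) : ℂ) ^ (s - 1 / 2) := by
      have hq : ((M / |v| : ℝ) : ℂ) ≠ 0 := by
        exact_mod_cast (div_pos hM0 (abs_pos.2 hv0)).ne'
      rw [cpow_add _ _ hq, cpow_intCast, ← mul_zpow,
        mul_comm (((M / |v| : ℝ) : ℂ) ^ (s - 1 / 2)), ← mul_assoc, ← mul_zpow]
      congr 2
      have hmm : (M : ℂ) * M = m * m := by
        rw [hM, ← ofReal_mul, abs_mul_abs_self]; push_cast; rfl
      have hmC : (m : ℂ) ≠ 0 := by exact_mod_cast hm
      rw [habsv, hv]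
      push_cast
      have hcC' : ((c : ℕ) : ℂ) ≠ 0 := by exact_mod_cast c.ne_zero
      field_simp
      linear_combination (weightSign k : ℂ) * hmm
    -- As |v| = cy, both sides are M^(s-1/2) c^(1/2-s) y^(1/2); this is checked on real logarithms,
    -- which avoids branch questions.
    have e3 : (z.im : ℂ) ^ s * ((M / |v| : ℝ) : ℂ) ^ (s - 1 / 2) =
        (M : ℂ) ^ (2 * s - 1) / ((M * (c : ℕ) : ℝ) : ℂ) ^ s * (Real.sqrt (|v| * M) : ℂ) := by
      have hq : 0 < M / |v| := div_pos hM0 (abs_pos.2 hv0)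
      have hcr := hc.le
      have hlog : ∀ {a : ℝ}, 0 < a → ∀ w : ℂ, (a : ℂ) ^ w = cexp (Real.log a * w) := by
        intro a ha w
        rw [cpow_def_of_ne_zero (by exact_mod_cast ha.ne'), ofReal_log ha.le]
      have hsq : (Real.sqrt (|v| * M) : ℂ) = cexp (Real.log (|v| * M) * (1 / 2)) := by
        rw [Real.sqrt_eq_rpow, ofReal_cpow (by positivity), hlog (mul_pos (abs_pos.2 hv0) hM0)]
        push_cast; rfl
      rw [hsq, hlog hy, hlog hq, hlog hM0, hlog (mul_pos hM0 hc), ← Complex.exp_add,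
        ← Complex.exp_sub, ← Complex.exp_add, Real.log_div hM0.ne' (abs_pos.2 hv0).ne',
        Real.log_mul (abs_pos.2 hv0).ne' hM0.ne', Real.log_mul hM0.ne' hc.ne', habsv,
        Real.log_mul hc.ne' hy.ne']
      congr 1
      push_cast
      ring
    have e4 : s + r - 1 / 2 = s - 1 / 2 + r := by ring
    rw [e1, e4]
    push_cast at e2 e3 ⊢
    linear_combination (cexp (2 * Real.pi * I * (m * ((c : ℕ) * z.re))) *
      (2 * besselK (s - 1 / 2 + r) (2 * Real.pi * (|v| * M))) *
      (laguerrePNonneg n r (4 * Real.pi * m * v) : ℂ)) *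
      ((z.im : ℂ) ^ s * e2 + (((m : ℂ) * (c : ℕ)) / ((M : ℂ) * (c : ℕ))) ^ r *
        (weightSign k : ℂ) ^ r * e3)
  have hsum := Finset.sum_congr rfl hmain
  rw [← Finset.mul_sum, ← Finset.mul_sum] at hsum
  rw [← hsum]
  linear_combination ((z.im : ℂ) ^ s * cexp (2 * Real.pi * I * m * ((c : ℕ) * z.re : ℝ))) * hstep

/-- The zeroth Fourier coefficient of a row sum. -/
theorem fourier_coefficient_zero {k : ℤ} (n : ℕ) (z : UpperHalfPlane) {s : ℂ}
    (hs : 1 < s.re) (c : ℕ+) :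
    (Real.pi : ℂ) ^ (-s) * Gamma (s + n) * ((z.im : ℂ) ^ s *
      𝓕 (latticeKernel n (weightSign k * ((c : ℕ) * z.im)) s) 0) =
      (Real.pi : ℂ) ^ (-(s - 1 / 2)) * Gamma (s - 1 / 2) * (1 / ((c : ℕ) : ℂ) ^ (2 * s - 1)) *
        (∏ i ∈ Finset.range n, (1 - s + i)) * (z.im : ℂ) ^ (1 - s) := by
  have hy := z.im_pos
  have hc : (0 : ℝ) < (c : ℕ) := by exact_mod_cast c.pos
  have hpi : (Real.pi : ℂ) ≠ 0 := by exact_mod_cast Real.pi_pos.ne'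
  set v : ℝ := weightSign k * ((c : ℕ) * z.im) with hv
  have hv2 : v ^ 2 = ((c : ℕ) * z.im) ^ 2 := by
    rcases weightSign_eq_or k with h | h <;> rw [hv, h] <;> ring
  have hv0 : v ≠ 0 := by
    intro h; rw [h] at hv2
    have : 0 < ((c : ℕ) * z.im) ^ 2 := by positivity
    linarith [hv2.symm ▸ (by norm_num : (0 : ℝ) ^ 2 = 0)]
  have hF := fourier_latticeKernel_zero n hv0 (s := s) (by linarith)
  have hpi2 : (Real.pi : ℂ) ^ (-s) = (Real.pi : ℂ) ^ (-(s + n)) * (Real.pi : ℂ) ^ n := by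
    rw [← cpow_natCast, ← cpow_add _ _ hpi]; congr 1; ring
  have hpi3 : (Real.pi : ℂ) ^ n * (Real.pi : ℂ) ^ (-(n : ℤ)) = 1 := by
    rw [zpow_neg, zpow_natCast]
    field_simp
  have hpow : (1 / (Real.pi * v ^ 2 : ℝ) : ℂ) ^ (s - 1 / 2) * (z.im : ℂ) ^ s =
      (Real.pi : ℂ) ^ (-(s - 1 / 2)) * (1 / ((c : ℕ) : ℂ) ^ (2 * s - 1)) * (z.im : ℂ) ^ (1 - s) := by
    have hlog : ∀ {a : ℝ}, 0 < a → ∀ w : ℂ, (a : ℂ) ^ w = cexp (Real.log a * w) := by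
      intro a ha w
      rw [cpow_def_of_ne_zero (by exact_mod_cast ha.ne'), ofReal_log ha.le]
    have hr : (1 / (Real.pi * v ^ 2 : ℝ) : ℂ) = ((1 / (Real.pi * v ^ 2) : ℝ) : ℂ) := by push_cast; rfl
    have hcc : ((c : ℕ) : ℂ) = (((c : ℕ) : ℝ) : ℂ) := by push_cast; rfl
    rw [hr, hcc, hlog (by positivity), hlog hy, hlog hy, hlog hc, hlog Real.pi_pos, one_div (cexp _),
      ← Complex.exp_neg, ← Complex.exp_add, ← Complex.exp_add, ← Complex.exp_add, one_div,
      Real.log_inv, hv2, Real.log_mul Real.pi_pos.ne' (by positivity), Real.log_pow,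
      Real.log_mul hc.ne' hy.ne']
    congr 1
    push_cast
    ring
  rw [hpi2]
  linear_combination ((Real.pi : ℂ) ^ n * (z.im : ℂ) ^ s) * hF +
    ((1 / (Real.pi * v ^ 2 : ℝ) : ℂ) ^ (s - 1 / 2) * (z.im : ℂ) ^ s * Gamma (s - 1 / 2) *
      ∏ i ∈ Finset.range n, (1 - s + i)) * hpi3 +
    (Gamma (s - 1 / 2) * ∏ i ∈ Finset.range n, (1 - s + i)) * hpow

end NonholomorphicEisenstein
end

/-! ### Poisson summation and the expansion for Re s > 1 -/

noncomputable section

namespace NonholomorphicEisenstein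

open Complex Set Filter FourierTransform Asymptotics

/-- The Fourier expansion of a row sum, multiplied by its Gamma factor. -/
theorem tsum_rowTerm {k : ℤ} {n : ℕ} (hk : |k| = 2 * n) (z : UpperHalfPlane) {s : ℂ}
    (hs : 1 < s.re) (c : ℕ+) :
    (Real.pi : ℂ) ^ (-s) * Gamma (s + n) * ∑' d : ℤ, rowTerm k z s (c : ℕ) d =
      (Real.pi : ℂ) ^ (-(s - 1 / 2)) * Gamma (s - 1 / 2) * (1 / ((c : ℕ) : ℂ) ^ (2 * s - 1)) *
        (∏ i ∈ Finset.range n, (1 - s + i)) * (z.im : ℂ) ^ (1 - s) +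
      (2 : ℂ) ^ (-|k|) * ∑' m : {m : ℤ // m ≠ 0}, rowFourierTerm k z s (c, m) := by
  have hy := z.im_pos
  have hc : (0 : ℝ) < (c : ℕ) := by exact_mod_cast c.pos
  have hpi : (Real.pi : ℂ) ≠ 0 := by exact_mod_cast Real.pi_pos.ne'
  set v : ℝ := weightSign k * ((c : ℕ) * z.im) with hv
  have hv0 : v ≠ 0 := by
    have : (c : ℕ) * z.im ≠ 0 := by positivity
    rcases weightSign_eq_or k with h | h <;> rw [hv, h] <;> simpa using this
  set Θ : ℂ := (Real.pi : ℂ) ^ (-s) * Gamma (s + n) with hΘ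
  have hΘ0 : Θ ≠ 0 := by
    refine mul_ne_zero (by simp [cpow_eq_zero_iff, hpi]) (Gamma_ne_zero_of_re_pos ?_)
    rw [add_re, natCast_re]
    have : (0 : ℝ) ≤ n := n.cast_nonneg
    linarith
  have hys : (z.im : ℂ) ^ s ≠ 0 := by
    have : (z.im : ℂ) ≠ 0 := by exact_mod_cast hy.ne'
    simp [cpow_eq_zero_iff, this]
  set b : ℤ → ℂ := fun m => Θ * ((z.im : ℂ) ^ s * (𝓕 (latticeKernel n v s) (m : ℝ) *
    cexp (2 * Real.pi * I * m * ((c : ℕ) * z.re : ℝ)))) with hb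
  have hbm : ∀ m : {m : ℤ // m ≠ 0}, b m.1 = (2 : ℂ) ^ (-|k|) * rowFourierTerm k z s (c, m) :=
    fun m => fourier_coefficient hk z hs (c, m)
  have hrow : Summable fun m : {m : ℤ // m ≠ 0} => rowFourierTerm k z s (c, m) :=
    (summable_rowFourierTerm hk z s).prod_factor c
  have hbsum : Summable b := by
    have h : Summable fun m : {m : ℤ // m ≠ 0} => b m.1 := by
      simp_rw [hbm]
      exact hrow.mul_left _
    exact (Set.finite_singleton (0 : ℤ)).summable_compl_iff.1 h
  -- Poisson summation needs the Fourier side summable. This follows from the explicit coefficients,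
  -- on dividing out the nonzero factor Θ y^s and a phase of absolute value 1.
  have hF : Summable fun m : ℤ => 𝓕 (latticeKernel n v s) (m : ℝ) := by
    refine Summable.of_norm ((hbsum.norm.mul_left (‖Θ‖ * ‖(z.im : ℂ) ^ s‖)⁻¹).congr fun m => ?_)
    have h1 : ‖cexp (2 * Real.pi * I * m * ((c : ℕ) * z.re : ℝ))‖ = 1 := by
      rw [show (2 * Real.pi * I * m * ((c : ℕ) * z.re : ℝ) : ℂ) =
        ((2 * Real.pi * m * ((c : ℕ) * z.re) : ℝ) : ℂ) * I by push_cast; ring,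
        Complex.norm_exp_ofReal_mul_I]
    have h2 := norm_ne_zero_iff.2 hΘ0
    have h3 := norm_ne_zero_iff.2 hys
    simp only [hb, norm_mul, h1, mul_one]
    field_simp
  -- The kernel decays like |x|^(-2 Re s), with exponent above 1; the translates are taken at the
  -- point c Re z.
  have hP := Real.tsum_eq_tsum_fourier_of_rpow_decay_of_summable (continuous_latticeKernel n hv0 s)
    (b := 2 * s.re) (by linarith) (isBigO_latticeKernel n hv0 (by linarith)) hF ((c : ℕ) * z.re)
  have h1 : Θ * ∑' d : ℤ, rowTerm k z s (c : ℕ) d = ∑' m : ℤ, b m := by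
    simp_rw [rowTerm_eq_latticeKernel hk z s c.pos]
    rw [tsum_mul_left, hP, ← tsum_mul_left, ← tsum_mul_left]
    refine tsum_congr fun m => ?_
    rw [hb, fourier_coe_apply]
    simp
  rw [h1, hbsum.tsum_eq_add_tsum_ite 0]
  have h2 : b 0 = Θ * ((z.im : ℂ) ^ s * 𝓕 (latticeKernel n v s) 0) := by
    rw [hb]
    simp only [Int.cast_zero, mul_zero, zero_mul, Complex.exp_zero, mul_one]
  rw [h2, hΘ, hv, fourier_coefficient_zero n z hs c, ← tsum_mul_left]
  congr 1
  simp_rw [← hbm]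
  rw [show (∑' m : {m : ℤ // m ≠ 0}, b m.1) = ∑' m : ({m : ℤ | m ≠ 0} : Set ℤ), b m from rfl,
    tsum_subtype]
  refine tsum_congr fun m => ?_
  by_cases hm : m = 0 <;> simp [hm]

/-- The Fourier expansion in the half plane of convergence. -/
theorem completedEisenstein_eq_fourierExpansion {k : ℤ} (hke : Even k) {n : ℕ} (hk : |k| = 2 * n)
    (z : UpperHalfPlane) {s : ℂ} (hs : 1 < s.re) :
    completedEisenstein k hke z s = fourierExpansion k z s := by
  have h2s : 1 < (2 * s - 1).re := by simp; linarith
  obtain ⟨hz1, hz2⟩ := zeta_eq_tsum_pnat h2s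
  have hE := zeta_mul_eisenstein hke z hs
  rw [completedEisenstein, fourierExpansion, theta_one_sub_of_one_lt_re hk hs,
    theta_of_one_lt_re hk hs, mul_assoc _ (riemannZeta (2 * s)) (eisenstein k hke z s), hE, mul_add,
    ← tsum_mul_left]
  simp_rw [tsum_rowTerm hk z hs]
  -- Over all c the zero frequencies sum to ζ(2s - 1), which completes θ_k(1 - s) y^(1-s); the other
  -- frequencies are regrouped into the divisor sums.
  rw [Summable.tsum_add, tsum_mul_left, tsum_rowFourierTerm hk z s, tsum_mul_right, tsum_mul_right,
    tsum_mul_left, ← hz2]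
  · ring
  · exact ((hz1.of_norm.mul_left _).mul_right _).mul_right _
  · exact (summable_rowFourierTerm hk z s).prod.mul_left _

end NonholomorphicEisenstein

end

/-! ### The theorem -/

theorem theorem1p1 (k : ℤ) (hk : Even k) :
    -- the Fourier expansion of the (convergent) completed Eisenstein series for Re s > 1
    (∀ (z : UpperHalfPlane) (s : ℂ), 1 < s.re →
      Summable (NonholomorphicEisenstein.cosetTerm k hk z s) ∧
      NonholomorphicEisenstein.completedEisenstein k hk z s =
        NonholomorphicEisenstein.fourierExpansion k z s) ∧
    -- the series converges absolutely, at every point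
    (∀ (z : UpperHalfPlane) (s : ℂ),
      Summable fun m : {m : ℤ // m ≠ 0} => ‖NonholomorphicEisenstein.fourierTerm k m z s‖) ∧
    -- the series, and the series of absolute values, converge uniformly on compacta
    (∀ C : Set (UpperHalfPlane × ℂ), IsCompact C →
      SummableUniformlyOn
        (fun (m : {m : ℤ // m ≠ 0}) (p : UpperHalfPlane × ℂ) =>
          NonholomorphicEisenstein.fourierTerm k m p.1 p.2) C ∧
      SummableUniformlyOn
        (fun (m : {m : ℤ // m ≠ 0}) (p : UpperHalfPlane × ℂ) =>
          ‖NonholomorphicEisenstein.fourierTerm k m p.1 p.2‖) C) ∧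
    -- the right hand side is the meromorphic continuation, which is entire for k ≠ 0
    (∀ z : UpperHalfPlane, ∃ F : ℂ → ℂ,
      Meromorphic F ∧
      (∀ s : ℂ, 1 < s.re → F s = NonholomorphicEisenstein.completedEisenstein k hk z s) ∧
      (∀ s : ℂ, s ≠ 1 / 2 → (k = 0 → s ≠ 0 ∧ s ≠ 1) →
        F s = NonholomorphicEisenstein.fourierExpansion k z s) ∧
      (k ≠ 0 → Differentiable ℂ F)) := by
  obtain ⟨n, hn⟩ : ∃ n : ℕ, |k| = 2 * (n : ℤ) := by
    obtain ⟨j, hj⟩ := hk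
    exact ⟨j.natAbs, by rw [hj, ← two_mul, abs_mul, Int.abs_eq_natAbs j]; rfl⟩
  have hn0 : n = 0 → k = 0 := by
    rintro rfl
    simpa using hn
  refine ⟨fun z s hs => ⟨(NonholomorphicEisenstein.summable_cosetTerm hk z hs).of_norm,
      NonholomorphicEisenstein.completedEisenstein_eq_fourierExpansion hk hn z hs⟩,
    fun z s => NonholomorphicEisenstein.summable_norm_fourierTerm hn z s,
    fun C hC => NonholomorphicEisenstein.summableUniformlyOn_fourierTerm hn hC, fun z => ?_⟩
  have hd : Differentiable ℂ fun s => (2 : ℂ) ^ (-|k|) *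
      ∑' m : {m : ℤ // m ≠ 0}, NonholomorphicEisenstein.fourierTerm k m z s :=
    (NonholomorphicEisenstein.differentiable_tsum_fourierTerm hn z).const_mul _
  have hF : ∀ s : ℂ, s ≠ 1 / 2 → (k = 0 → s ≠ 0 ∧ s ≠ 1) →
      NonholomorphicEisenstein.constantTerm n z.im s + (2 : ℂ) ^ (-|k|) *
        ∑' m : {m : ℤ // m ≠ 0}, NonholomorphicEisenstein.fourierTerm k m z s =
      NonholomorphicEisenstein.fourierExpansion k z s := by
    intro s h1 h2
    rw [NonholomorphicEisenstein.constantTerm_eq hn z.im h1 fun h => h2 (hn0 h),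
      NonholomorphicEisenstein.fourierExpansion]
  -- The continuation uses `constantTerm` because at a pole `theta` takes only the default value of
  -- a nonexistent limit, which would spoil differentiability at 1/2.
  refine ⟨fun s => NonholomorphicEisenstein.constantTerm n z.im s + (2 : ℂ) ^ (-|k|) *
        ∑' m : {m : ℤ // m ≠ 0}, NonholomorphicEisenstein.fourierTerm k m z s, ?_, ?_, hF, ?_⟩
  · exact (NonholomorphicEisenstein.meromorphic_constantTerm n z.im_pos).add
      fun x => (hd.analyticAt x).meromorphicAt
  · intro s hs
    rw [NonholomorphicEisenstein.completedEisenstein_eq_fourierExpansion hk hn z hs]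
    refine hF s ?_ fun _ => ⟨?_, ?_⟩ <;> rintro rfl <;> norm_num at hs
  · intro hk0
    have hn1 : n ≠ 0 := by
      rintro rfl
      exact hk0 (hn0 rfl)
    exact (NonholomorphicEisenstein.differentiable_constantTerm hn1 z.im_pos).add hd
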